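/- Let $\lambda$ be a partition, and let $X=\{x_a\}_{a\in A}$ and $Y=\{y_b\}_{b\in B}$ be two alphabets of independent commuting variables, finite or infinite, indexed by totally ordered sets $A$ and $B$. Let $\mathrm{Sym}$ be the algebra of symmetric functions over $\mathbb{Q}$, and let $f\mapsto f[X-Y]$ be the unique morphism of $\mathbb{Q}$-algebras from $\mathrm{Sym}$ to the formal power series in the variables $x_a,y_b$ such that $p_k[X-Y]=\sum_{a} x_a^k-\sum_{b} y_b^k$ for every power sum $p_k$, $k\ge 1$. The letters of $X-Y$ are a positive letter $a$ of weight $x_a$ for each $a\in A$, and a negative letter $-b$ of weight $-y_b$ for each $b\in B$; every negative letter is smaller than every positive letter, and letters of the same sign are ordered by their indices (so $-b<-b'$ if and only if $b<b'$). A signed tableau $T$ of shape $\lambda$ is a filling of the diagram of $\lambda$ (in French notation) with letters of $X-Y$ whose entries weakly increase along rows (from left to right) and columns (from bottom to top), such that the positive letters strictly increase in each column and the negative letters strictly increase in each row. The weight $\mathrm{wt}(T)$ is the product of the weights of the entries of $T$. Then $$ s_\lambda[X-Y]=\sum_{T}\mathrm{wt}(T), $$ where $s_\lambda\in\mathrm{Sym}$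 is the Schur function of $\lambda$ and the sum is over all signed tableaux $T$ of shape $\lambda$ (coefficientwise a finite sum if the alphabets are infinite). -/

import Mathlib

noncomputable section

open MvPowerSeries

/-- The algebra `Sym` of symmetric functions over `ℚ` in the variables `x₀, x₁, x₂, …`: formal power
series of bounded degree that are invariant under all permutations of the variables. -/
def SymFun : Subalgebra ℚ (MvPowerSeries ℕ ℚ) where
  carrier := {f | (∀ (e : Equiv.Perm ℕ) (m : ℕ →₀ ℕ), coeff (m.equivMapDomain e) f = coeff m f) ∧
    ∃ d : ℕ, ∀ m : ℕ →₀ ℕ, d < m.degree → coeff m f = 0}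
  add_mem' := by
    rintro f g ⟨hf, d, hd⟩ ⟨hg, d', hd'⟩
    refine ⟨fun e m => by simp [hf, hg], max d d', fun m hm => ?_⟩
    simp [hd m (lt_of_le_of_lt (le_max_left _ _) hm), hd' m (lt_of_le_of_lt (le_max_right _ _) hm)]
  mul_mem' := by
    classical
    rintro f g ⟨hf, d, hd⟩ ⟨hg, d', hd'⟩
    refine ⟨fun e m => ?_, d + d', fun m hm => ?_⟩
    · rw [coeff_mul, coeff_mul]
      symm
      refine Finset.sum_nbij' (fun p => (p.1.equivMapDomain e, p.2.equivMapDomain e))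
        (fun p => (p.1.equivMapDomain e.symm, p.2.equivMapDomain e.symm)) ?_ ?_ ?_ ?_ ?_
      · rintro ⟨a, b⟩ h
        rw [Finset.HasAntidiagonal.mem_antidiagonal] at h ⊢
        subst h; ext i; simp
      · rintro ⟨a, b⟩ h
        rw [Finset.HasAntidiagonal.mem_antidiagonal] at h ⊢
        ext i; simpa using DFunLike.congr_fun h (e i)
      · rintro ⟨a, b⟩ h
        ext i <;> simp
      · rintro ⟨a, b⟩ h
        ext i <;> simp
      · rintro ⟨a, b⟩ h
        simp [hf, hg]
    · rw [coeff_mul]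
      refine Finset.sum_eq_zero ?_
      rintro ⟨a, b⟩ h
      rw [Finset.HasAntidiagonal.mem_antidiagonal] at h
      subst h
      simp only [map_add] at hm
      rcases lt_or_ge d a.degree with h | h
      · simp [hd a h]
      · simp [hd' b (by omega)]
  algebraMap_mem' := by
    classical
    intro r
    refine ⟨fun e m => ?_, 0, fun m hm => ?_⟩
    · simp only [MvPowerSeries.algebraMap_apply, coeff_C]
      congr 1
      simp only [eq_iff_iff]
      constructor
      · intro h; ext i; simpa using DFunLike.congr_fun h (e i)
      · rintro rfl; simp
    · simp only [MvPowerSeries.algebraMap_apply, coeff_C]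
      rw [if_neg]; rintro rfl; simp at hm

open Classical in
/-- The power sum `p_k[X] = ∑ x_i ^ k` (for `k ≥ 1`) of the alphabet of variables indexed by `σ`. -/
def powerSum (σ : Type*) (k : ℕ) : MvPowerSeries σ ℚ :=
  fun m => if ∃ i, m = Finsupp.single i k then 1 else 0

open Classical in
theorem coeff_powerSum {σ : Type*} (k : ℕ) (m : σ →₀ ℕ) :
    coeff m (powerSum σ k) = if ∃ i, m = Finsupp.single i k then 1 else 0 := rfl

theorem powerSum_mem (k : ℕ) : powerSum ℕ k ∈ SymFun := by
  refine ⟨fun e m => ?_, k, fun m hm => ?_⟩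
  · rw [coeff_powerSum, coeff_powerSum]
    congr 1
    simp only [eq_iff_iff]
    constructor
    · rintro ⟨i, hi⟩
      refine ⟨e.symm i, ?_⟩
      ext j
      have := DFunLike.congr_fun hi (e j)
      simpa [Finsupp.single_apply, Equiv.symm_apply_eq] using this
    · rintro ⟨i, rfl⟩
      exact ⟨e i, by simp⟩
  · rw [coeff_powerSum, if_neg]
    rintro ⟨i, rfl⟩
    simp at hm

namespace SymFun

/-- The power sum `p_k` as an element of `Sym`. -/
def p (k : ℕ) : SymFun := ⟨powerSum ℕ k, powerSum_mem k⟩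

theorem killCompl_powerSum (n k : ℕ) (hk : k ≠ 0) :
    killCompl Fin.valEmbedding (powerSum ℕ k) =
      ((MvPolynomial.psum (Fin n) ℚ k : MvPolynomial (Fin n) ℚ) : MvPowerSeries (Fin n) ℚ) := by
  classical
  ext m
  rw [coeff_killCompl, coeff_powerSum, MvPolynomial.coeff_coe, MvPolynomial.psum,
    MvPolynomial.coeff_sum]
  simp only [MvPolynomial.coeff_X_pow]
  by_cases h : ∃ i : Fin n, m = Finsupp.single i k
  · obtain ⟨i, rfl⟩ := h
    rw [if_pos ⟨i, by simp⟩, Finset.sum_eq_single i]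
    · simp
    · intro j _ hj
      rw [if_neg]
      rw [Finsupp.single_left_inj hk]; exact hj
    · simp
  · rw [if_neg, Finset.sum_eq_zero]
    · intro i _
      rw [if_neg]
      rintro rfl; exact h ⟨i, rfl⟩
    · rintro ⟨i, hi⟩
      have hs : i ∈ (Finsupp.embDomain Fin.valEmbedding m).support := by rw [hi]; simp [hk]
      rw [Finsupp.support_embDomain, Finset.mem_map] at hs
      obtain ⟨j, -, rfl⟩ := hs
      refine h ⟨j, ?_⟩
      rw [← Finsupp.embDomain_single] at hi
      exact Finsupp.embDomain_injective _ hi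

theorem esymm_mem_adjoin (n k : ℕ) : MvPolynomial.esymm (Fin n) ℚ k ∈
    Algebra.adjoin ℚ (Set.range fun i : Fin n => MvPolynomial.psum (Fin n) ℚ (i + 1)) := by
  induction k using Nat.strong_induction_on with
  | _ k ih =>
    rcases Nat.eq_zero_or_pos k with rfl | hk
    · rw [MvPolynomial.esymm_zero]; exact one_mem _
    rcases lt_or_ge n k with hnk | hnk
    · have : MvPolynomial.esymm (Fin n) ℚ k = 0 := by
        rw [MvPolynomial.esymm, Finset.powersetCard_eq_empty.2 (by simpa using hnk)]; simp
      rw [this]; exact zero_mem _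
    have h := MvPolynomial.mul_esymm_eq_sum (Fin n) ℚ k
    have hk0 : (k : ℚ) ≠ 0 := by exact_mod_cast hk.ne'
    have h2 : MvPolynomial.esymm (Fin n) ℚ k =
        (k : ℚ)⁻¹ • ((k : MvPolynomial (Fin n) ℚ) * MvPolynomial.esymm (Fin n) ℚ k) := by
      rw [← nsmul_eq_mul, ← Nat.cast_smul_eq_nsmul ℚ, smul_smul, inv_mul_cancel₀ hk0, one_smul]
    rw [h2, h]
    refine Subalgebra.smul_mem _ (mul_mem (pow_mem (neg_mem (one_mem _)) _) (sum_mem ?_)) _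
    rintro ⟨a, b⟩ hab
    simp only [Finset.mem_filter, Finset.HasAntidiagonal.mem_antidiagonal] at hab
    refine mul_mem (mul_mem (pow_mem (neg_mem (one_mem _)) _) (ih a hab.2)) ?_
    refine Algebra.subset_adjoin ⟨⟨b - 1, by omega⟩, ?_⟩
    simp only
    congr 1; omega

theorem isSymmetric_mem_adjoin (n : ℕ) (f : MvPolynomial (Fin n) ℚ) (hf : f.IsSymmetric) :
    f ∈ Algebra.adjoin ℚ (Set.range fun i : Fin n => MvPolynomial.psum (Fin n) ℚ (i + 1)) := by
  obtain ⟨q, hq⟩ := (MvPolynomial.esymmAlgHom_fin_bijective ℚ n).2 ⟨f, hf⟩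
  have h2 := MvPolynomial.esymmAlgHom_apply (σ := Fin n) q
  rw [hq] at h2
  simp only at h2
  rw [h2]
  have : (MvPolynomial.aeval fun i : Fin n => MvPolynomial.esymm (Fin n) ℚ (i + 1)) q ∈
      (MvPolynomial.aeval (R := ℚ) fun i : Fin n =>
        MvPolynomial.esymm (Fin n) ℚ (i + 1)).range := ⟨q, rfl⟩
  rw [← Algebra.adjoin_range_eq_range_aeval] at this
  refine Algebra.adjoin_le ?_ this
  rintro _ ⟨i, rfl⟩
  exact esymm_mem_adjoin n _

theorem injective_of_surjective {R : Type*} [CommRing R] [IsNoetherianRing R] (f : R →+* R)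
    (hf : Function.Surjective f) : Function.Injective f := by
  have hc : ∀ n : ℕ, ((f ^ (n + 1) : R →+* R) : R → R) = f ∘ (f ^ n : R →+* R) := by
    intro n; rw [pow_succ']; rfl
  have hs : ∀ n : ℕ, Function.Surjective (f ^ n : R →+* R) := by
    intro n
    induction n with
    | zero => exact fun x => ⟨x, rfl⟩
    | succ n ih => rw [hc]; exact hf.comp ih
  obtain ⟨n, hn⟩ := monotone_stabilizes_iff_noetherian.2 ‹IsNoetherianRing R›
    ⟨fun n : ℕ => RingHom.ker (f ^ n : R →+* R), monotone_nat_of_le_succ (fun n x hx => by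
      rw [RingHom.mem_ker] at hx ⊢
      rw [hc, Function.comp_apply, hx, map_zero])⟩
  rw [injective_iff_map_eq_zero]
  intro x hx
  obtain ⟨y, rfl⟩ := hs n x
  have h1 : y ∈ RingHom.ker (f ^ (n + 1) : R →+* R) := by
    rw [RingHom.mem_ker, hc]; exact hx
  have h2 : RingHom.ker (f ^ n : R →+* R) = RingHom.ker (f ^ (n + 1) : R →+* R) :=
    hn (n + 1) (Nat.le_succ n)
  rw [← h2] at h1
  exact h1

theorem aeval_psum_injective (n : ℕ) : Function.Injective
    (MvPolynomial.aeval (R := ℚ) fun i : Fin n => MvPolynomial.psum (Fin n) ℚ (i + 1)) := by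
  let ψ : MvPolynomial (Fin n) ℚ →ₐ[ℚ] MvPolynomial.symmetricSubalgebra (Fin n) ℚ :=
    MvPolynomial.aeval fun i => ⟨MvPolynomial.psum (Fin n) ℚ (i + 1),
      MvPolynomial.psum_isSymmetric (Fin n) ℚ _⟩
  have hψ : (MvPolynomial.symmetricSubalgebra (Fin n) ℚ).val.comp ψ =
      MvPolynomial.aeval fun i : Fin n => MvPolynomial.psum (Fin n) ℚ (i + 1) := by
    apply MvPolynomial.algHom_ext
    intro i
    simp [ψ]
  have hsurj : Function.Surjective ψ := by
    rintro ⟨f, hf⟩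
    have h := isSymmetric_mem_adjoin n f hf
    rw [Algebra.adjoin_range_eq_range_aeval, ← hψ] at h
    obtain ⟨q, hq⟩ := h
    exact ⟨q, Subtype.ext hq⟩
  let χ := (MvPolynomial.esymmAlgEquiv (R := ℚ) (Fin n) (Fintype.card_fin n)).symm
  have hinj : Function.Injective (χ.toAlgHom.comp ψ) := by
    have hs : Function.Surjective (χ.toAlgHom.comp ψ) := χ.surjective.comp hsurj
    exact injective_of_surjective (χ.toAlgHom.comp ψ).toRingHom hs
  rw [← hψ]
  intro a b hab
  have hab' : ψ a = ψ b := Subtype.ext hab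
  exact hinj (by simp [hab'])

/-- The algebra morphism `ℚ[t₀, t₁, …] → Sym` with `t_k ↦ p_{k+1}`. -/
def ofPoly : MvPolynomial ℕ ℚ →ₐ[ℚ] SymFun := MvPolynomial.aeval fun k => p (k + 1)

theorem killCompl_ofPoly (n : ℕ) (P : MvPolynomial ℕ ℚ) :
    killCompl Fin.valEmbedding (ofPoly P : MvPowerSeries ℕ ℚ) =
      ((MvPolynomial.aeval (fun k : ℕ => MvPolynomial.psum (Fin n) ℚ (k + 1)) P :
        MvPolynomial (Fin n) ℚ) : MvPowerSeries (Fin n) ℚ) := by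
  have : ((killCompl Fin.valEmbedding).comp (SymFun.val.comp ofPoly) :
      MvPolynomial ℕ ℚ →ₐ[ℚ] MvPowerSeries (Fin n) ℚ) =
      (MvPolynomial.coeToMvPowerSeries.algHom ℚ).comp
        (MvPolynomial.aeval (fun k : ℕ => MvPolynomial.psum (Fin n) ℚ (k + 1))) := by
    apply MvPolynomial.algHom_ext
    intro k
    simp [ofPoly, p, killCompl_powerSum]
  have h := DFunLike.congr_fun this P
  simpa using h

theorem ofPoly_injective : Function.Injective ofPoly := by
  rw [injective_iff_map_eq_zero]
  intro P hP
  obtain ⟨n, Q, rfl⟩ : ∃ (n : ℕ) (Q : MvPolynomial (Fin n) ℚ),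
      P = MvPolynomial.rename (fun i : Fin n => (i : ℕ)) Q := by
    obtain ⟨n, hn⟩ : ∃ n, ∀ i ∈ P.vars, i < n :=
      ⟨P.vars.sup id + 1, fun i hi => Nat.lt_succ_of_le (Finset.le_sup (f := id) hi)⟩
    obtain ⟨Q, hQ⟩ := MvPolynomial.exists_rename_eq_of_vars_subset_range P
      (fun i : Fin n => (i : ℕ)) Fin.val_injective (fun i hi => ⟨⟨i, hn i hi⟩, rfl⟩)
    exact ⟨n, Q, hQ.symm⟩
  have h := killCompl_ofPoly n (MvPolynomial.rename (fun i : Fin n => (i : ℕ)) Q)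
  rw [hP, MvPolynomial.aeval_rename] at h
  have h2 : MvPolynomial.aeval (fun i : Fin n => MvPolynomial.psum (Fin n) ℚ (i + 1)) Q = 0 := by
    apply MvPolynomial.coe_injective
    rw [MvPolynomial.coe_zero]
    simpa [Function.comp_def] using h.symm
  rw [aeval_psum_injective n (h2.trans (map_zero _).symm), map_zero]


theorem mem_range_ofPoly (f : SymFun)
    (hf : f.1 ∈ Algebra.adjoin ℚ (Set.range fun k : ℕ => powerSum ℕ (k + 1))) :
    f ∈ ofPoly.range := by
  have h : (Set.range fun k : ℕ => powerSum ℕ (k + 1)) =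
      SymFun.val '' (Set.range fun k : ℕ => p (k + 1)) := by
    rw [← Set.range_comp]; rfl
  rw [h, ← AlgHom.map_adjoin, Algebra.adjoin_range_eq_range_aeval] at hf
  obtain ⟨g, hg, hgf⟩ := hf
  rwa [show f = g from Subtype.ext hgf.symm]

theorem ofPoly_mem_adjoin (P : MvPolynomial ℕ ℚ) :
    (ofPoly P).1 ∈ Algebra.adjoin ℚ (Set.range fun k : ℕ => powerSum ℕ (k + 1)) := by
  have h : (Set.range fun k : ℕ => powerSum ℕ (k + 1)) =
      SymFun.val '' (Set.range fun k : ℕ => p (k + 1)) := by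
    rw [← Set.range_comp]; rfl
  rw [h, ← AlgHom.map_adjoin, Algebra.adjoin_range_eq_range_aeval]
  exact ⟨_, ⟨P, rfl⟩, rfl⟩

theorem exists_perm_eqOn (s : Finset ℕ) (g : ℕ → ℕ) (hg : Set.InjOn g s) :
    ∃ e ∈ Subgroup.closure {σ : Equiv.Perm ℕ | σ.IsSwap}, ∀ i ∈ s, e i = g i := by
  classical
  induction s using Finset.induction_on with
  | empty => exact ⟨1, one_mem _, by simp⟩
  | insert a s ha ih =>
    obtain ⟨e, he, hes⟩ := ih (hg.mono (by simp))
    have hmem : Equiv.swap (e a) (g a) ∈ Subgroup.closure {σ : Equiv.Perm ℕ | σ.IsSwap} := by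
      by_cases h : e a = g a
      · rw [h, Equiv.swap_self]; exact one_mem _
      · exact Subgroup.subset_closure ⟨_, _, h, rfl⟩
    refine ⟨Equiv.swap (e a) (g a) * e, mul_mem hmem he, fun i hi => ?_⟩
    rw [Equiv.Perm.mul_apply]
    rcases Finset.mem_insert.1 hi with rfl | hi'
    · simp
    · have hne : i ≠ a := fun h => ha (h ▸ hi')
      rw [Equiv.swap_apply_of_ne_of_ne, hes i hi']
      · exact fun h => hne (e.injective h)
      · rw [hes i hi']
        exact fun h => hne (hg (by simp [hi']) (by simp) h)

theorem homogeneousComponent_mul' (f g : MvPowerSeries ℕ ℚ) (j : ℕ) :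
    homogeneousComponent j (f * g) = ∑ a ∈ Finset.HasAntidiagonal.antidiagonal j,
      homogeneousComponent a.1 f * homogeneousComponent a.2 g := by
  classical
  ext m
  rw [coeff_homogeneousComponent, map_sum]
  simp only [coeff_mul, coeff_homogeneousComponent]
  rw [Finset.sum_comm]
  by_cases hm : m.degree = j
  · rw [if_pos hm]
    refine Finset.sum_congr rfl ?_
    rintro ⟨u, v⟩ huv
    rw [Finset.HasAntidiagonal.mem_antidiagonal] at huv
    rw [Finset.sum_eq_single (u.degree, v.degree)]
    · simp
    · rintro ⟨a, b⟩ _ hab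
      simp only [ne_eq, Prod.mk.injEq, not_and_or] at hab
      rcases hab with h | h
      · rw [if_neg (Ne.symm h), zero_mul]
      · simp only
        rw [if_neg (c := v.degree = b) (Ne.symm h), mul_zero]
    · intro h
      refine absurd ?_ h
      rw [Finset.HasAntidiagonal.mem_antidiagonal, ← hm, ← huv]
      exact (map_add Finsupp.degree u v).symm
  · rw [if_neg hm]
    symm
    refine Finset.sum_eq_zero ?_
    rintro ⟨u, v⟩ huv
    refine Finset.sum_eq_zero ?_
    rintro ⟨a, b⟩ hab
    rw [Finset.HasAntidiagonal.mem_antidiagonal] at huv hab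
    simp only at huv hab ⊢
    split_ifs with h1 h2
    · exfalso
      apply hm
      rw [← huv, map_add, h1, h2, hab]
    all_goals simp

theorem homogeneousComponent_mem (f : MvPowerSeries ℕ ℚ)
    (hf : f ∈ Algebra.adjoin ℚ (Set.range fun k : ℕ => powerSum ℕ (k + 1))) (j : ℕ) :
    homogeneousComponent j f ∈
      Algebra.adjoin ℚ (Set.range fun k : ℕ => powerSum ℕ (k + 1)) := by
  classical
  induction hf using Algebra.adjoin_induction generalizing j with
  | mem x hx =>
    obtain ⟨k, rfl⟩ := hx
    have : homogeneousComponent j (powerSum ℕ (k + 1)) =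
        if k + 1 = j then powerSum ℕ (k + 1) else 0 := by
      ext m
      rw [coeff_homogeneousComponent, coeff_powerSum]
      by_cases h : ∃ i, m = Finsupp.single i (k + 1)
      · obtain ⟨i, rfl⟩ := h
        rw [Finsupp.degree_single]
        split_ifs with h1 h2
        · rw [coeff_powerSum, if_pos ⟨i, rfl⟩]
        · exact absurd ⟨i, rfl⟩ h2
        · simp
      · rw [if_neg h, ite_self]
        split_ifs
        · rw [coeff_powerSum, if_neg h]
        · simp
    rw [this]
    split_ifs
    · exact Algebra.subset_adjoin ⟨k, rfl⟩
    · exact zero_mem _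
  | algebraMap r =>
    have : homogeneousComponent j (algebraMap ℚ (MvPowerSeries ℕ ℚ) r) =
        if j = 0 then algebraMap ℚ (MvPowerSeries ℕ ℚ) r else 0 := by
      ext m
      rw [coeff_homogeneousComponent, MvPowerSeries.algebraMap_apply]
      by_cases hj : j = 0
      · subst hj
        simp only [coeff_C, if_true]
        split_ifs with h1 h2 h2
        · rfl
        · rfl
        · subst h2; simp at h1
        · rfl
      · rw [if_neg hj, coeff_C]
        split_ifs with h1 h2
        · subst h2; simp at h1; exact absurd h1.symm hj
        · simp
        · simp
    rw [this]
    split_ifs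
    · exact Subalgebra.algebraMap_mem _ r
    · exact zero_mem _
  | add x y _ _ hx hy => rw [map_add]; exact add_mem (hx j) (hy j)
  | mul x y _ _ hx hy =>
    rw [homogeneousComponent_mul']
    exact sum_mem fun a _ => mul_mem (hx _) (hy _)

theorem eq_of_killCompl_eq (f g : SymFun) (d : ℕ)
    (hf : ∀ m : ℕ →₀ ℕ, d < m.degree → coeff m f.1 = 0)
    (hg : ∀ m : ℕ →₀ ℕ, d < m.degree → coeff m g.1 = 0)
    (h : killCompl (Fin.valEmbedding (n := d)) f.1 = killCompl Fin.valEmbedding g.1) : f = g := by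
  apply Subtype.ext
  ext m
  rcases lt_or_ge d m.degree with hm | hm
  · rw [hf m hm, hg m hm]
  have hcard : m.support.card ≤ d := by
    refine le_trans ?_ hm
    rw [Finsupp.degree_apply, Finset.card_eq_sum_ones]
    exact Finset.sum_le_sum fun i hi => Nat.one_le_iff_ne_zero.2 (Finsupp.mem_support_iff.1 hi)
  obtain ⟨e, he⟩ : ∃ e : Equiv.Perm ℕ, ∀ i ∈ m.support, e i < d := by
    classical
    obtain ⟨e, -, he⟩ := exists_perm_eqOn m.support
      (fun i => if h : i ∈ m.support then (m.support.equivFin ⟨i, h⟩ : ℕ) else 0) (by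
        intro i hi j hj hij
        have hi' : i ∈ m.support := hi
        have hj' : j ∈ m.support := hj
        simp only [dif_pos hi', dif_pos hj', Fin.val_inj, EmbeddingLike.apply_eq_iff_eq] at hij
        exact congrArg Subtype.val hij)
    refine ⟨e, fun i hi => ?_⟩
    rw [he i hi, dif_pos hi]
    exact lt_of_lt_of_le (Fin.is_lt _) hcard
  have hr : m.equivMapDomain e ∈
      Set.range (Finsupp.embDomain (M := ℕ) (Fin.valEmbedding (n := d))) := by
    rw [Finsupp.mem_range_embDomain_iff]
    intro j hj
    have hj' : m (e.symm j) ≠ 0 := by simpa using hj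
    exact ⟨⟨j, by simpa using he (e.symm j) (by simpa using hj')⟩, rfl⟩
  obtain ⟨u, hu⟩ := hr
  have h2 := congrArg (coeff u) h
  rw [coeff_killCompl, coeff_killCompl, hu, f.2.1, g.2.1] at h2
  exact h2

theorem ofPoly_surjective : Function.Surjective ofPoly := by
  classical
  rintro ⟨f, hf⟩
  obtain ⟨hsym, d, hd⟩ := id hf
  let F : MvPowerSeries (Fin d) ℚ := killCompl Fin.valEmbedding f
  have hF : ∀ u : Fin d →₀ ℕ, d < u.degree → coeff u F = 0 := by
    intro u hu
    rw [coeff_killCompl]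
    apply hd
    rwa [Finsupp.embDomain_eq_mapDomain, Finsupp.degree_mapDomain]
  let P₀ : MvPolynomial (Fin d) ℚ := truncTotal (d + 1) F
  have hP₀ : (P₀ : MvPowerSeries (Fin d) ℚ) = F := by
    ext u
    rw [MvPolynomial.coeff_coe, coeff_truncTotal_eq_ite]
    split_ifs with h
    · rfl
    · exact (hF u (by omega)).symm
  have hsymP : P₀.IsSymmetric := by
    intro e
    ext u
    obtain ⟨v, rfl⟩ : ∃ v : Fin d →₀ ℕ, u = v.mapDomain e :=
      ⟨u.mapDomain e.symm, by rw [← Finsupp.mapDomain_comp]; simp⟩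
    rw [MvPolynomial.coeff_rename_mapDomain _ e.injective, ← MvPolynomial.coeff_coe,
      ← MvPolynomial.coeff_coe, hP₀, coeff_killCompl, coeff_killCompl]
    obtain ⟨e', -, he'⟩ := exists_perm_eqOn (Finset.range d)
      (fun i => if h : i < d then (e ⟨i, h⟩ : ℕ) else 0) (by
        intro i hi j hj hij
        have hi' : i < d := by simpa using hi
        have hj' : j < d := by simpa using hj
        simp only [dif_pos hi', dif_pos hj', Fin.val_inj, EmbeddingLike.apply_eq_iff_eq] at hij
        simpa using hij)
    rw [← hsym e' (Finsupp.embDomain Fin.valEmbedding v)]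
    refine congrArg (fun w => coeff w f) ?_
    rw [Finsupp.equivMapDomain_eq_mapDomain, Finsupp.embDomain_eq_mapDomain,
      Finsupp.embDomain_eq_mapDomain, ← Finsupp.mapDomain_comp, ← Finsupp.mapDomain_comp]
    apply Finsupp.mapDomain_congr
    intro i _
    simp [he' i (by simp)]
  obtain ⟨Q, hQ⟩ : ∃ Q : MvPolynomial (Fin d) ℚ,
      MvPolynomial.aeval (fun i : Fin d => MvPolynomial.psum (Fin d) ℚ (i + 1)) Q = P₀ := by
    have h := isSymmetric_mem_adjoin d P₀ hsymP
    rw [Algebra.adjoin_range_eq_range_aeval] at h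
    exact h
  let g₀ : SymFun := ofPoly (MvPolynomial.rename (fun i : Fin d => (i : ℕ)) Q)
  have hg₀ : killCompl Fin.valEmbedding g₀.1 = F := by
    rw [killCompl_ofPoly, MvPolynomial.aeval_rename, ← hP₀, ← hQ]
    rfl
  let g : MvPowerSeries ℕ ℚ := ∑ j ∈ Finset.range (d + 1), homogeneousComponent j g₀.1
  have hgA : g ∈ Algebra.adjoin ℚ (Set.range fun k : ℕ => powerSum ℕ (k + 1)) :=
    sum_mem fun j _ => homogeneousComponent_mem _ (ofPoly_mem_adjoin _) j
  have hgS : g ∈ SymFun := by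
    refine Algebra.adjoin_le ?_ hgA
    rintro _ ⟨k, rfl⟩
    exact powerSum_mem _
  have hgc : ∀ m : ℕ →₀ ℕ, coeff m g = if m.degree < d + 1 then coeff m g₀.1 else 0 := by
    intro m
    simp [g, coeff_homogeneousComponent]
  have hfg : (⟨f, hf⟩ : SymFun) = ⟨g, hgS⟩ := by
    refine eq_of_killCompl_eq _ _ d hd (fun m hm => ?_) ?_
    · rw [hgc, if_neg (by omega)]
    · ext u
      rw [coeff_killCompl (p := g), hgc, ← coeff_killCompl, hg₀, Finsupp.embDomain_eq_mapDomain, Finsupp.degree_mapDomain]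
      split_ifs with h
      · rfl
      · exact hF u (by omega)
  have := mem_range_ofPoly ⟨g, hgS⟩ hgA
  rw [← hfg] at this
  exact this

/-- The power sums `p₁, p₂, …` are algebraically independent generators of `Sym`. -/
def powerSumEquiv : MvPolynomial ℕ ℚ ≃ₐ[ℚ] SymFun :=
  AlgEquiv.ofBijective ofPoly ⟨ofPoly_injective, ofPoly_surjective⟩

/-- The specialization `f ↦ f[A]` at the virtual alphabet `A` given by the sequence
`a k = p_k[A]` (`k ≥ 1`): the unique morphism of algebras `Sym → R` with `p_k ↦ a k` for all
`k ≥ 1`. The value `a 0` is not used. -/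
def specialize {R : Type*} [CommRing R] [Algebra ℚ R] (a : ℕ → R) : SymFun →ₐ[ℚ] R :=
  (MvPolynomial.aeval fun k => a (k + 1)).comp powerSumEquiv.symm.toAlgHom

theorem specialize_p {R : Type*} [CommRing R] [Algebra ℚ R] (a : ℕ → R) (k : ℕ) (hk : k ≠ 0) :
    specialize a (p k) = a k := by
  obtain ⟨k, rfl⟩ := Nat.exists_eq_succ_of_ne_zero hk
  have h : powerSumEquiv (MvPolynomial.X k) = p (k + 1) := by
    simp [powerSumEquiv, ofPoly]
  rw [Nat.succ_eq_add_one, ← h]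
  simp [specialize]

end SymFun

namespace SemistandardYoungTableau

variable {μ : YoungDiagram}

/-- The content of a tableau: the exponent of `x_i` in `x ^ T` is the number of entries equal to
`i`. -/
def content (T : SemistandardYoungTableau μ) : ℕ →₀ ℕ :=
  ∑ c ∈ μ.cells, Finsupp.single (T c.1 c.2) 1

theorem content_apply (T : SemistandardYoungTableau μ) (x : ℕ) :
    T.content x = (μ.cells.filter fun c => T c.1 c.2 = x).card := by
  rw [content, Finsupp.finsetSum_apply, Finset.card_filter]
  simp only [Finsupp.single_apply]

theorem exists_rowBound (T : SemistandardYoungTableau μ) (x r : ℕ) :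
    ∃ j, (r, j) ∉ μ ∨ x ≤ T r j := by
  obtain ⟨j, hj⟩ := μ.exists_notMem_row r
  exact ⟨j, Or.inl hj⟩

/-- The number of entries of row `r` that are less than `x`. -/
def rowBound (T : SemistandardYoungTableau μ) (x r : ℕ) : ℕ := by
  classical exact Nat.find (T.exists_rowBound x r)

theorem lt_rowBound (T : SemistandardYoungTableau μ) (x r j : ℕ) :
    j < T.rowBound x r ↔ (r, j) ∈ μ ∧ T r j < x := by
  classical
  rw [rowBound, Nat.lt_find_iff]
  constructor
  · intro h
    have := h j le_rfl
    push Not at this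
    exact this
  · rintro ⟨h1, h2⟩ i hi
    push Not
    exact ⟨μ.up_left_mem le_rfl hi h1, lt_of_le_of_lt (T.row_weak_of_le hi h1) h2⟩

theorem le_of_forall_lt_imp {a b : ℕ} (h : ∀ j, j < a → j < b) : a ≤ b := by
  by_contra hab
  exact lt_irrefl _ (h b (by omega))

theorem rowBound_eq (T : SemistandardYoungTableau μ) (x r n : ℕ)
    (h : ∀ j, j < n ↔ (r, j) ∈ μ ∧ T r j < x) : T.rowBound x r = n :=
  le_antisymm (le_of_forall_lt_imp fun j hj => (h j).2 ((T.lt_rowBound x r j).1 hj))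
    (le_of_forall_lt_imp fun j hj => (T.lt_rowBound x r j).2 ((h j).1 hj))

def bkLower (T : SemistandardYoungTableau μ) (k r : ℕ) : ℕ :=
  max (T.rowBound k r) (T.rowBound (k + 2) (r + 1))

def bkUpper (T : SemistandardYoungTableau μ) (k : ℕ) : ℕ → ℕ
  | 0 => T.rowBound (k + 2) 0
  | r + 1 => min (T.rowBound (k + 2) (r + 1)) (T.rowBound k r)

def bkBound (T : SemistandardYoungTableau μ) (k r : ℕ) : ℕ :=
  T.bkUpper k r + T.bkLower k r - T.rowBound (k + 1) r

theorem bkLower_le (T : SemistandardYoungTableau μ) (k r : ℕ) :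
    T.bkLower k r ≤ T.rowBound (k + 1) r := by
  refine max_le ?_ ?_ <;> refine le_of_forall_lt_imp fun j hj => ?_
  · rw [lt_rowBound] at hj ⊢
    exact ⟨hj.1, by omega⟩
  · rw [lt_rowBound] at hj ⊢
    have := T.col_strict (Nat.lt_add_one r) hj.1
    exact ⟨μ.up_left_mem (Nat.le_succ r) le_rfl hj.1, by omega⟩

theorem le_bkUpper (T : SemistandardYoungTableau μ) (k r : ℕ) :
    T.rowBound (k + 1) r ≤ T.bkUpper k r := by
  have h : T.rowBound (k + 1) r ≤ T.rowBound (k + 2) r := by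
    refine le_of_forall_lt_imp fun j hj => ?_
    rw [lt_rowBound] at hj ⊢
    exact ⟨hj.1, by omega⟩
  cases r with
  | zero => exact h
  | succ r =>
    refine le_min h (le_of_forall_lt_imp fun j hj => ?_)
    rw [lt_rowBound] at hj ⊢
    have := T.col_strict (Nat.lt_add_one r) hj.1
    exact ⟨μ.up_left_mem (Nat.le_succ r) le_rfl hj.1, by omega⟩

theorem bkUpper_le (T : SemistandardYoungTableau μ) (k r : ℕ) :
    T.bkUpper k r ≤ T.rowBound (k + 2) r := by
  cases r with
  | zero => exact le_rfl
  | succ r => exact min_le_left _ _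

theorem bkBound_mem (T : SemistandardYoungTableau μ) (k r : ℕ) :
    T.bkLower k r ≤ T.bkBound k r ∧ T.bkBound k r ≤ T.bkUpper k r := by
  have h1 := T.bkLower_le k r
  have h2 := T.le_bkUpper k r
  unfold bkBound
  omega

/-- The Bender–Knuth involution, which exchanges the numbers of entries `k` and `k + 1`; it is used
only to prove that Schur functions are symmetric. -/
def bk (k : ℕ) (T : SemistandardYoungTableau μ) : SemistandardYoungTableau μ where
  entry r j := if (r, j) ∈ μ ∧ (T r j = k ∨ T r j = k + 1) then
    (if j < T.bkBound k r then k else k + 1) else T r j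
  row_weak' := by
    intro i j1 j2 hj h2
    have h1 := μ.up_left_mem le_rfl hj.le h2
    have := T.row_weak hj h2
    simp only [h1, h2, true_and]
    split_ifs <;> omega
  col_strict' := by
    intro i1 i2 j hi h2
    have h1 := μ.up_left_mem hi.le le_rfl h2
    have hlt := T.col_strict hi h2
    simp only [h1, h2, true_and]
    by_cases hb : T i1 j = k ∧ T i2 j = k + 1
    · have hi2 : i2 = i1 + 1 := by
        by_contra hne
        have h3 := μ.up_left_mem (show i1 + 1 ≤ i2 by omega) le_rfl h2
        have h4 := T.col_strict (Nat.lt_add_one i1) h3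
        have h5 := T.col_strict (show i1 + 1 < i2 by omega) h2
        omega
      subst hi2
      have h3 : j < T.bkBound k i1 := by
        refine lt_of_lt_of_le ?_ (T.bkBound_mem k i1).1
        refine lt_of_lt_of_le ?_ (le_max_right _ _)
        rw [lt_rowBound]
        exact ⟨h2, by omega⟩
      have h4 : ¬ j < T.bkBound k (i1 + 1) := by
        intro h
        have h5 := lt_of_lt_of_le (lt_of_lt_of_le h (T.bkBound_mem k (i1 + 1)).2)
          (min_le_right _ _)
        rw [lt_rowBound] at h5
        omega
      rw [if_pos (Or.inl hb.1), if_pos h3, if_pos (Or.inr hb.2), if_neg h4]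
      omega
    · split_ifs <;> omega
  zeros' := by
    intro i j h
    rw [if_neg (fun h' => h h'.1), T.zeros h]

theorem bk_apply (k : ℕ) (T : SemistandardYoungTableau μ) (r j : ℕ) :
    bk k T r j = if (r, j) ∈ μ ∧ (T r j = k ∨ T r j = k + 1) then
    (if j < T.bkBound k r then k else k + 1) else T r j := rfl

theorem rowBound_bk_of_ne (k : ℕ) (T : SemistandardYoungTableau μ) (x r : ℕ) (hx : x ≠ k + 1) :
    (bk k T).rowBound x r = T.rowBound x r := by
  refine rowBound_eq _ _ _ _ fun j => ?_
  rw [lt_rowBound, bk_apply]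
  refine and_congr_right fun h => ?_
  split_ifs <;> omega

theorem rowBound_bk (k : ℕ) (T : SemistandardYoungTableau μ) (r : ℕ) :
    (bk k T).rowBound (k + 1) r = T.bkBound k r := by
  refine rowBound_eq _ _ _ _ fun j => ?_
  obtain ⟨h1, h2⟩ := T.bkBound_mem k r
  have h1' := le_trans (le_max_left _ _) h1
  have h2' := le_trans h2 (T.bkUpper_le k r)
  have ha := T.lt_rowBound k r j
  have hc := T.lt_rowBound (k + 2) r j
  rw [bk_apply]
  by_cases hm : (r, j) ∈ μ
  · simp only [hm, true_and] at ha hc ⊢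
    split_ifs <;> omega
  · simp only [hm, false_and, iff_false] at ha hc ⊢
    omega

theorem bkLower_bk (k : ℕ) (T : SemistandardYoungTableau μ) (r : ℕ) :
    (bk k T).bkLower k r = T.bkLower k r := by
  rw [bkLower, rowBound_bk_of_ne _ _ _ _ (by omega), rowBound_bk_of_ne _ _ _ _ (by omega), bkLower]

theorem bkUpper_bk (k : ℕ) (T : SemistandardYoungTableau μ) (r : ℕ) :
    (bk k T).bkUpper k r = T.bkUpper k r := by
  cases r with
  | zero => rw [bkUpper, rowBound_bk_of_ne _ _ _ _ (by omega), bkUpper]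
  | succ r =>
    rw [bkUpper, rowBound_bk_of_ne _ _ _ _ (by omega), rowBound_bk_of_ne _ _ _ _ (by omega),
      bkUpper]

theorem bkBound_bk (k : ℕ) (T : SemistandardYoungTableau μ) (r : ℕ) :
    (bk k T).bkBound k r = T.rowBound (k + 1) r := by
  rw [bkBound, bkUpper_bk, bkLower_bk, rowBound_bk, bkBound]
  have h1 := T.bkLower_le k r
  have h2 := T.le_bkUpper k r
  omega

theorem bk_bk (k : ℕ) (T : SemistandardYoungTableau μ) : bk k (bk k T) = T := by
  ext r j
  have hb := T.lt_rowBound (k + 1) r j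
  rw [bk_apply, bkBound_bk, bk_apply]
  by_cases hm : (r, j) ∈ μ
  · simp only [hm, true_and] at hb ⊢
    split_ifs <;> omega
  · simp only [hm, false_and, if_false]

theorem card_lt_eq (T : SemistandardYoungTableau μ) (x : ℕ) :
    (μ.cells.filter fun c => T c.1 c.2 < x).card =
      ∑ r ∈ Finset.range (μ.colLen 0), T.rowBound x r := by
  rw [Finset.card_eq_sum_card_fiberwise (f := Prod.fst) (t := Finset.range (μ.colLen 0))]
  · refine Finset.sum_congr rfl fun r _ => ?_
    rw [← Finset.card_range (T.rowBound x r)]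
    symm
    refine Finset.card_bij (fun j _ => (r, j)) ?_ ?_ ?_
    · intro j hj
      rw [Finset.mem_range, lt_rowBound] at hj
      simpa using hj
    · intro j _ j' _ h
      exact (Prod.ext_iff.1 h).2
    · rintro ⟨r', j⟩ h
      simp only [Finset.mem_filter, YoungDiagram.mem_cells] at h
      obtain ⟨h, rfl⟩ := h
      exact ⟨j, by rw [Finset.mem_range, lt_rowBound]; exact h, rfl⟩
  · rintro ⟨r, j⟩ h
    simp only [Finset.coe_filter, YoungDiagram.mem_cells, Set.mem_ofPred_eq] at h
    simp only [Finset.coe_range, Set.mem_Iio]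
    exact YoungDiagram.mem_iff_lt_colLen.1 (μ.up_left_mem le_rfl (Nat.zero_le j) h.1)

theorem sum_succ_eq (T : SemistandardYoungTableau μ) (x : ℕ) :
    ∑ r ∈ Finset.range (μ.colLen 0), T.rowBound (x + 1) r =
      ∑ r ∈ Finset.range (μ.colLen 0), T.rowBound x r + T.content x := by
  rw [← card_lt_eq, ← card_lt_eq, content_apply, ← Finset.card_union_of_disjoint]
  · congr 1
    ext c
    simp only [Finset.mem_filter, Finset.mem_union]
    constructor
    · rintro ⟨h1, h2⟩
      rcases Nat.lt_succ_iff_lt_or_eq.1 h2 with h | h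
      · exact Or.inl ⟨h1, h⟩
      · exact Or.inr ⟨h1, h⟩
    · rintro (⟨h1, h2⟩ | ⟨h1, h2⟩) <;> exact ⟨h1, by omega⟩
  · rw [Finset.disjoint_filter]
    intro c _ h
    omega

theorem sum_bkBound (k : ℕ) (T : SemistandardYoungTableau μ) :
    ∑ r ∈ Finset.range (μ.colLen 0), T.bkBound k r +
        ∑ r ∈ Finset.range (μ.colLen 0), T.rowBound (k + 1) r =
      ∑ r ∈ Finset.range (μ.colLen 0), T.rowBound k r +
        ∑ r ∈ Finset.range (μ.colLen 0), T.rowBound (k + 2) r := by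
  have h : ∀ n, ∑ r ∈ Finset.range n, T.bkBound k r +
        ∑ r ∈ Finset.range n, T.rowBound (k + 1) r + T.bkUpper k n =
      ∑ r ∈ Finset.range n, T.rowBound k r +
        ∑ r ∈ Finset.range n, T.rowBound (k + 2) r + T.rowBound (k + 2) n := by
    intro n
    induction n with
    | zero => simp [bkUpper]
    | succ n ih =>
      simp only [Finset.sum_range_succ]
      have h1 := T.bkLower_le k n
      have h2 := T.le_bkUpper k n
      have h3 : T.bkBound k n = T.bkUpper k n + T.bkLower k n - T.rowBound (k + 1) n := rfl
      have h4 : T.bkLower k n + T.bkUpper k (n + 1) =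
          T.rowBound k n + T.rowBound (k + 2) (n + 1) := by
        simp only [bkLower, bkUpper]
        omega
      omega
  have h0 : T.rowBound (k + 2) (μ.colLen 0) = 0 := by
    refine rowBound_eq _ _ _ _ fun j => ?_
    simp only [Nat.not_lt_zero, false_iff, not_and]
    intro hm
    have := YoungDiagram.mem_iff_lt_colLen.1 (μ.up_left_mem le_rfl (Nat.zero_le j) hm)
    omega
  have h1 := h (μ.colLen 0)
  have h2 := T.bkUpper_le k (μ.colLen 0)
  omega

theorem content_bk (k : ℕ) (T : SemistandardYoungTableau μ) :
    (bk k T).content = T.content.equivMapDomain (Equiv.swap k (k + 1)) := by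
  ext x
  rw [Finsupp.equivMapDomain_apply, Equiv.symm_swap]
  have hs := (bk k T).sum_succ_eq x
  have e1 := T.sum_succ_eq k
  have e2 := T.sum_succ_eq (k + 1)
  have e3 := T.sum_bkBound k
  by_cases hx : x = k
  · subst hx
    simp only [rowBound_bk, rowBound_bk_of_ne x T x _ (by omega)] at hs
    simp only [show x + 1 + 1 = x + 2 from rfl] at e2
    rw [Equiv.swap_apply_left]
    omega
  by_cases hx' : x = k + 1
  · subst hx'
    simp only [rowBound_bk, rowBound_bk_of_ne k T (k + 1 + 1) _ (by omega)] at hs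
    simp only [show k + 1 + 1 = k + 2 from rfl] at hs e2
    rw [Equiv.swap_apply_right]
    omega
  · simp only [rowBound_bk_of_ne k T x _ hx', rowBound_bk_of_ne k T (x + 1) _ (by omega)] at hs
    rw [Equiv.swap_apply_of_ne_of_ne hx hx']
    have := T.sum_succ_eq x
    omega

end SemistandardYoungTableau

open MvPowerSeries

/-- The generating function `∑ x ^ T` of the semistandard tableaux of shape `μ`: the coefficient of
`x ^ m` is the (finite) number of semistandard tableaux of content `m`. -/
def schurSeries (μ : YoungDiagram) : MvPowerSeries ℕ ℚ :=
  fun m => (Nat.card {T : SemistandardYoungTableau μ // T.content = m} : ℚ)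

theorem coeff_schurSeries (μ : YoungDiagram) (m : ℕ →₀ ℕ) : coeff m (schurSeries μ) =
    (Nat.card {T : SemistandardYoungTableau μ // T.content = m} : ℚ) := rfl

theorem coeff_schurSeries_swap_succ (μ : YoungDiagram) (k : ℕ) (m : ℕ →₀ ℕ) :
    coeff (m.equivMapDomain (Equiv.swap k (k + 1))) (schurSeries μ) =
      coeff m (schurSeries μ) := by
  have hinv : ∀ m : ℕ →₀ ℕ, (m.equivMapDomain (Equiv.swap k (k + 1))).equivMapDomain
      (Equiv.swap k (k + 1)) = m := by
    intro m; ext; simp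
  rw [coeff_schurSeries, coeff_schurSeries]
  congr 1
  refine Nat.card_congr ⟨fun T => ⟨T.1.bk k, ?_⟩, fun T => ⟨T.1.bk k, ?_⟩, fun T => ?_, fun T => ?_⟩
  · rw [SemistandardYoungTableau.content_bk, T.2, hinv]
  · rw [SemistandardYoungTableau.content_bk, T.2]
  · exact Subtype.ext (T.1.bk_bk k)
  · exact Subtype.ext (T.1.bk_bk k)

theorem coeff_schurSeries_perm (μ : YoungDiagram) (e : Equiv.Perm ℕ) (m : ℕ →₀ ℕ) :
    coeff (m.equivMapDomain e) (schurSeries μ) = coeff m (schurSeries μ) := by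
  let H : Subgroup (Equiv.Perm ℕ) :=
    { carrier := {e | ∀ m : ℕ →₀ ℕ,
        coeff (m.equivMapDomain e) (schurSeries μ) = coeff m (schurSeries μ)}
      mul_mem' := by
        intro a b ha hb m
        have : m.equivMapDomain (a * b) = (m.equivMapDomain b).equivMapDomain a := by
          ext; simp [Equiv.Perm.mul_def]
        rw [this, ha, hb]
      one_mem' := by
        intro m
        have : m.equivMapDomain (1 : Equiv.Perm ℕ) = m := by ext; simp [Equiv.Perm.one_def]
        rw [this]
      inv_mem' := by
        intro a ha m
        have : (m.equivMapDomain a⁻¹).equivMapDomain a = m := by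
          ext; simp [Equiv.Perm.inv_def]
        rw [← ha, this] }
  have hsucc : ∀ k, Equiv.swap k (k + 1) ∈ H := fun k m => coeff_schurSeries_swap_succ μ k m
  have hlt : ∀ i n, Equiv.swap i (i + n + 1) ∈ H := by
    intro i n
    induction n with
    | zero => exact hsucc i
    | succ n ih =>
      have := Equiv.swap_mul_swap_mul_swap (x := i) (y := i + n + 1) (z := i + n + 1 + 1)
        (by omega) (by omega)
      rw [show i + (n + 1) + 1 = i + n + 1 + 1 by omega, Equiv.swap_comm, ← this]
      exact mul_mem (mul_mem (hsucc _) ih) (hsucc _)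
  have hcl : Subgroup.closure {σ : Equiv.Perm ℕ | σ.IsSwap} ≤ H := by
    rw [Subgroup.closure_le]
    rintro _ ⟨i, j, hij, rfl⟩
    rcases lt_or_gt_of_ne hij with h | h
    · obtain ⟨n, rfl⟩ := Nat.exists_eq_add_of_lt h
      exact hlt i n
    · obtain ⟨n, rfl⟩ := Nat.exists_eq_add_of_lt h
      rw [Equiv.swap_comm]
      exact hlt j n
  obtain ⟨e', he', hee'⟩ := SymFun.exists_perm_eqOn m.support e e.injective.injOn
  have : m.equivMapDomain e = m.equivMapDomain e' := by
    rw [Finsupp.equivMapDomain_eq_mapDomain, Finsupp.equivMapDomain_eq_mapDomain]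
    exact Finsupp.mapDomain_congr fun i hi => (hee' i hi).symm
  rw [this]
  exact hcl he' m

theorem schurSeries_mem (μ : YoungDiagram) : schurSeries μ ∈ SymFun := by
  refine ⟨coeff_schurSeries_perm μ, μ.card, fun m hm => ?_⟩
  rw [coeff_schurSeries]
  have : IsEmpty {T : SemistandardYoungTableau μ // T.content = m} := by
    refine ⟨fun T => ?_⟩
    have h := T.2
    rw [← h, SemistandardYoungTableau.content, map_sum] at hm
    simp at hm
  simp

/-- The Schur function `s_μ`, as an element of `Sym`. -/
def SymFun.schur (μ : YoungDiagram) : SymFun := ⟨schurSeries μ, schurSeries_mem μ⟩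

/-- A signed tableau of shape `μ` for the alphabet `X - Y`, where the positive letters are indexed by
`α` and the negative ones by `β`. The letters form the ordered sum `β ⊕ₗ α`: every negative letter
`Sum.inlₗ b` is smaller than every positive letter `Sum.inrₗ a`, and letters of the same sign are
ordered by their indices. A cell is a pair (row, column). -/
structure SignedTableau (α β : Type*) [LinearOrder α] [LinearOrder β] (μ : YoungDiagram) where
  entry : μ.cells → β ⊕ₗ α
  row_weak : ∀ c d : μ.cells, c.1.1 = d.1.1 → c.1.2 < d.1.2 → entry c ≤ entry d
  col_weak : ∀ c d : μ.cells, c.1.2 = d.1.2 → c.1.1 < d.1.1 → entry c ≤ entry d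
  pos_col_strict : ∀ c d : μ.cells, c.1.2 = d.1.2 → c.1.1 < d.1.1 →
    ∀ a a' : α, entry c = Sum.inrₗ a → entry d = Sum.inrₗ a' → a < a'
  neg_row_strict : ∀ c d : μ.cells, c.1.1 = d.1.1 → c.1.2 < d.1.2 →
    ∀ b b' : β, entry c = Sum.inlₗ b → entry d = Sum.inlₗ b' → b < b'

/-- The weight of a letter: `x_a` for a positive letter, `-y_b` for a negative letter. The variables
are `x_a = X (Sum.inl a)` and `y_b = X (Sum.inr b)`. -/
def letterWeight {α β : Type*} (l : β ⊕ₗ α) : MvPowerSeries (α ⊕ β) ℚ :=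
  Sum.elim (fun b => -X (Sum.inr b)) (fun a => X (Sum.inl a)) (ofLex l)

/-- The weight of a signed tableau: the product of the weights of its entries. -/
def SignedTableau.weight {α β : Type*} [LinearOrder α] [LinearOrder β] {μ : YoungDiagram}
    (T : SignedTableau α β μ) : MvPowerSeries (α ⊕ β) ℚ :=
  ∏ c : μ.cells, letterWeight (T.entry c)

/-- The power sums `p_k[X - Y] = p_k[X] - p_k[Y]` (for `k ≥ 1`) of the difference of alphabets. -/
def powerSumDiff (α β : Type*) (k : ℕ) : MvPowerSeries (α ⊕ β) ℚ :=
  rename (Function.Embedding.inl : α ↪ α ⊕ β) (powerSum α k) -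
    rename (Function.Embedding.inr : β ↪ α ⊕ β) (powerSum β k)

end

open scoped MvPowerSeries.WithPiTopology

/-!
Both sides of the identity satisfy the same recursion on the alphabet, which removes the greatest
letter.

For tableaux, the cells that carry the greatest letter `l` form a horizontal strip if `l` is
positive and a vertical strip if it is negative, and the other cells form an arbitrary tableau in
the smaller letters (`SignedTableau.sum_tableauxIn_insert`).

For Schur functions, the same rule applied to semistandard tableaux in the variables `x_0, …, x_n`
says that substituting `p_k + t ^ k` for `p_k` turns `s_μ` into `∑ s_ν t ^ |μ / ν|`, where `μ / ν`
runs through the horizontal strips; as `n` grows this becomes an identity in `Sym[t]`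
(`SymFun.addVar_schur`), hence holds for every specialization of `Sym`
(`SymFun.specialize_add_schur`). Removing a variable `y` is the inverse operation. A sign-reversing
involution, which toggles a single cell, shows that the inverse is the alternating sum over vertical
strips (`YoungDiagram.sum_strips`), and this is the rule for a negative letter
(`SymFun.specialize_sub_schur`).

Induction on the greatest letter gives the identity for finite alphabets
(`SignedTableau.sum_tableauxIn_eq_specialize`). For arbitrary alphabets, the coefficient of a
monomial only involves the finitely many variables that occur in it: the morphism that sets the
others to `0` commutes with specialization, and a tableau using any other letter does not
contribute.
-/

noncomputable section

open MvPowerSeries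

/-! ### Specializations of `Sym` and restriction to a set of variables -/

namespace SymFun

/-- A morphism out of `Sym` is determined by its values on the power sums `p_k`, `k ≥ 1`. -/
theorem eq_specialize {R : Type*} [CommRing R] [Algebra ℚ R] (a : ℕ → R) (φ : SymFun →ₐ[ℚ] R)
    (h : ∀ k, k ≠ 0 → φ (p k) = a k) : φ = specialize a := by
  have hX : ∀ k, powerSumEquiv (MvPolynomial.X k) = p (k + 1) := fun k => by
    simp [powerSumEquiv, ofPoly]
  have key : φ.comp powerSumEquiv.toAlgHom = (specialize a).comp powerSumEquiv.toAlgHom := by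
    refine MvPolynomial.algHom_ext fun k => ?_
    simp [hX, h, specialize_p]
  refine AlgHom.ext fun f => ?_
  obtain ⟨P, rfl⟩ := powerSumEquiv.surjective f
  exact DFunLike.congr_fun key P

theorem map_specialize {R R' : Type*} [CommRing R] [Algebra ℚ R] [CommRing R'] [Algebra ℚ R']
    (a : ℕ → R) (φ : R →ₐ[ℚ] R') (f : SymFun) :
    φ (specialize a f) = specialize (fun k => φ (a k)) f := by
  rw [← eq_specialize (fun k => φ (a k)) (φ.comp (specialize a))
    fun k hk => by simp [specialize_p a k hk]]
  rfl

theorem specialize_congr {R : Type*} [CommRing R] [Algebra ℚ R] {a a' : ℕ → R}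
    (h : ∀ k, k ≠ 0 → a k = a' k) : specialize a = specialize a' :=
  eq_specialize _ _ fun k hk => (specialize_p a k hk).trans (h k hk)

end SymFun

/-- The endomorphism of the algebra of power series that sets the variables outside `s` to `0`. -/
def restrictVars {σ : Type*} (s : Set σ) : MvPowerSeries σ ℚ →ₐ[ℚ] MvPowerSeries σ ℚ :=
  (rename (Function.Embedding.subtype (· ∈ s))).comp (killCompl (Function.Embedding.subtype (· ∈ s)))

open Classical in
theorem coeff_restrictVars {σ : Type*} (s : Set σ) (f : MvPowerSeries σ ℚ) (m : σ →₀ ℕ) :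
    coeff m (restrictVars s f) = if (m.support : Set σ) ⊆ s then coeff m f else 0 := by
  rw [restrictVars, AlgHom.comp_apply]
  split_ifs with h
  · have hr : m ∈ Set.range (Finsupp.embDomain (M := ℕ) (Function.Embedding.subtype (· ∈ s))) := by
      rw [Finsupp.mem_range_embDomain_iff]
      intro i hi
      exact ⟨⟨i, h (by simpa using hi)⟩, rfl⟩
    obtain ⟨u, rfl⟩ := hr
    rw [coeff_embDomain_rename, coeff_killCompl]
  · refine coeff_rename_eq_zero _ _ ?_
    rintro ⟨u, rfl⟩
    refine h fun i hi => ?_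
    rw [← Finsupp.embDomain_eq_mapDomain,
      Finsupp.support_embDomain] at hi
    obtain ⟨j, -, rfl⟩ := Finset.mem_map.1 hi
    exact j.2

theorem coeff_restrictVars_of_subset {σ : Type*} {s : Set σ} (f : MvPowerSeries σ ℚ) {m : σ →₀ ℕ}
    (h : (m.support : Set σ) ⊆ s) : coeff m (restrictVars s f) = coeff m f := by
  rw [coeff_restrictVars, if_pos h]

theorem coeff_restrictVars_of_not_subset {σ : Type*} {s : Set σ} (f : MvPowerSeries σ ℚ)
    {m : σ →₀ ℕ} (h : ¬ (m.support : Set σ) ⊆ s) : coeff m (restrictVars s f) = 0 := by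
  rw [coeff_restrictVars, if_neg h]

open Classical in
/-- Setting variables to `0` in a power sum over the letters of a subset `P` leaves a finite sum. -/
theorem restrictVars_powerSum {σ : Type*} (s : Finset σ) (P : σ → Prop) {k : ℕ} (hk : k ≠ 0)
    (f : MvPowerSeries σ ℚ)
    (hf : ∀ m, coeff m f = if ∃ i, P i ∧ m = Finsupp.single i k then 1 else 0) :
    restrictVars s f = ∑ i ∈ s with P i, X i ^ k := by
  ext m
  rw [coeff_restrictVars, hf, map_sum]
  simp only [coeff_X_pow]
  by_cases h : ∃ i, P i ∧ m = Finsupp.single i k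
  · obtain ⟨i, hi, rfl⟩ := h
    rw [if_pos (⟨i, hi, rfl⟩ : ∃ j, P j ∧ Finsupp.single i k = Finsupp.single j k)]
    simp only [Finsupp.single_left_inj hk, Finsupp.support_single i hk]
    simp [hi]
  · rw [if_neg h, ite_self, Finset.sum_eq_zero]
    intro i hi
    rw [if_neg]
    rintro rfl
    exact h ⟨i, (Finset.mem_filter.1 hi).2, rfl⟩

/-! ### Horizontal and vertical strips -/

namespace YoungDiagram

/-- `μ / ν` is a horizontal strip: no two of its cells lie in the same column. Equivalently, every
cell of `μ` that lies below another cell of `μ` in its column belongs to `ν`. -/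
def IsHorizontalStrip (ν μ : YoungDiagram) : Prop :=
  ν ≤ μ ∧ ∀ i i' j, i < i' → (i', j) ∈ μ → (i, j) ∈ ν

/-- `μ / ν` is a vertical strip: no two of its cells lie in the same row. Equivalently, every
cell of `μ` that is not the last one of its row belongs to `ν`. -/
def IsVerticalStrip (ν μ : YoungDiagram) : Prop :=
  ν ≤ μ ∧ ∀ i j j', j < j' → (i, j') ∈ μ → (i, j) ∈ ν

theorem cells_injective : Function.Injective cells := fun _ _ h => YoungDiagram.ext h

theorem finite_setOf_le (μ : YoungDiagram) : {ν | ν ≤ μ}.Finite :=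
  Set.Finite.of_finite_image (f := cells)
    ((μ.cells.powerset : Finset _).finite_toSet.subset (by
      rintro _ ⟨ν, hν, rfl⟩
      exact Finset.mem_coe.2 (Finset.mem_powerset.2 hν)))
    cells_injective.injOn

/-- The finite set of the diagrams contained in `μ`. -/
def subdiagrams (μ : YoungDiagram) : Finset YoungDiagram := μ.finite_setOf_le.toFinset

@[simp]
theorem mem_subdiagrams {ν μ : YoungDiagram} : ν ∈ μ.subdiagrams ↔ ν ≤ μ := by
  simp [subdiagrams]

theorem card_le_card {ν μ : YoungDiagram} (h : ν ≤ μ) : ν.card ≤ μ.card := Finset.card_le_card h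

/-- If `κ` is strictly contained in `μ`, the last cell of the lowest row in which they differ. -/
theorem exists_toggle_cell {κ μ : YoungDiagram} (h : κ ≤ μ) (hne : κ ≠ μ) :
    ∃ i j, (i, j) ∈ μ ∧ (i, j) ∉ κ ∧ (∀ j', j < j' → (i, j') ∉ μ) ∧
      ∀ i', i' < i → (i', j) ∈ κ := by
  classical
  have hex : ∃ i j, (i, j) ∈ μ ∧ (i, j) ∉ κ := by
    by_contra! hc
    exact hne (le_antisymm h fun c hc' => hc c.1 c.2 hc')
  obtain ⟨j₀, hj₀, hj₀'⟩ := Nat.find_spec hex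
  set i := Nat.find hex with hi
  have hlt : j₀ < μ.rowLen i := mem_iff_lt_rowLen.1 hj₀
  refine ⟨i, μ.rowLen i - 1, mem_iff_lt_rowLen.2 (by omega), fun hm => hj₀' ?_, fun j' hj' hm => ?_,
    fun i' hi' => ?_⟩
  · exact κ.up_left_mem le_rfl (by omega) hm
  · have := mem_iff_lt_rowLen.1 hm
    omega
  · by_contra hm
    exact Nat.find_min hex hi' ⟨_, μ.up_left_mem hi'.le le_rfl (mem_iff_lt_rowLen.2 (by omega)), hm⟩

open Classical in
/-- The operations of removing a vertical strip with sign and of removing a horizontal strip are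
inverse to each other. -/
theorem sum_strips (R : Type*) [CommRing R] (κ μ : YoungDiagram) :
    ∑ ν ∈ μ.subdiagrams with IsVerticalStrip ν μ ∧ IsHorizontalStrip κ ν,
      (-1 : R) ^ (μ.card - ν.card) = if κ = μ then 1 else 0 := by
  split_ifs with hκ
  · subst hκ
    rw [Finset.sum_eq_single κ]
    · simp
    · intro ν hν hne
      simp only [Finset.mem_filter] at hν
      exact absurd (le_antisymm hν.2.1.1 hν.2.2.1) hne
    · intro hn
      refine absurd ?_ hn
      simp only [Finset.mem_filter, mem_subdiagrams]
      exact ⟨le_rfl, ⟨le_rfl, fun i j j' hj hm => κ.up_left_mem le_rfl hj.le hm⟩,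
        ⟨le_rfl, fun i i' j hj hm => κ.up_left_mem hj.le le_rfl hm⟩⟩
  by_cases hle : κ ≤ μ
  swap
  · refine Finset.sum_eq_zero fun ν hν => ?_
    simp only [Finset.mem_filter] at hν
    exact absurd (hν.2.2.1.trans hν.2.1.1) hle
  obtain ⟨i, j, hμ, hκc, hrow, hcol⟩ := exists_toggle_cell hle hκ
  -- Toggling the cell `(i, j)` is a sign-reversing involution without fixed points.
  have hmem : ∀ (ν : YoungDiagram) (c : ℕ × ℕ), c ∈ symmDiff ν.cells {(i, j)} ↔
      (c ≠ (i, j) ∧ c ∈ ν) ∨ (c = (i, j) ∧ (i, j) ∉ ν) := by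
    intro ν c
    simp only [Finset.mem_symmDiff, mem_cells, Finset.mem_singleton]
    constructor
    · rintro (⟨h1, h2⟩ | ⟨h1, h2⟩)
      · exact Or.inl ⟨h2, h1⟩
      · subst h1; exact Or.inr ⟨rfl, h2⟩
    · rintro (⟨h1, h2⟩ | ⟨h1, h2⟩)
      · exact Or.inl ⟨h2, h1⟩
      · subst h1; exact Or.inr ⟨rfl, h2⟩
  have hlow : ∀ ν, ν ∈ μ.subdiagrams.filter (fun ν => IsVerticalStrip ν μ ∧ IsHorizontalStrip κ ν) →
      IsLowerSet (SetLike.coe (symmDiff ν.cells {(i, j)})) := by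
    intro ν hν c d hdc hc
    simp only [Finset.mem_filter, mem_subdiagrams] at hν
    obtain ⟨-, ⟨hνμ, hv⟩, hκν, hh⟩ := hν
    rw [SetLike.mem_coe, hmem] at hc ⊢
    obtain ⟨c1, c2⟩ := c
    obtain ⟨d1, d2⟩ := d
    obtain ⟨h1, h2⟩ : d1 ≤ c1 ∧ d2 ≤ c2 := hdc
    by_cases hd : (d1, d2) = (i, j)
    · obtain ⟨rfl, rfl⟩ := Prod.mk.inj hd
      refine Or.inr ⟨rfl, fun hdν => ?_⟩
      rcases hc with ⟨hne, hc⟩ | ⟨-, hc⟩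
      · rcases eq_or_lt_of_le h1 with rfl | h1
        · have h2 : d2 < c2 := lt_of_le_of_ne h2 fun h => hne (by rw [h])
          exact hrow c2 h2 (hνμ hc)
        · exact hκc (hh _ _ _ h1 (ν.up_left_mem le_rfl h2 hc))
      · exact hc hdν
    · refine Or.inl ⟨hd, ?_⟩
      rcases hc with ⟨hne, hc⟩ | ⟨hc, -⟩
      · exact ν.up_left_mem h1 h2 hc
      · obtain ⟨rfl, rfl⟩ := Prod.mk.inj hc
        rcases eq_or_lt_of_le h2 with rfl | h2
        · exact hκν (hcol _ (lt_of_le_of_ne h1 fun h => hd (by rw [h])))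
        · exact ν.up_left_mem h1 le_rfl (hv _ _ _ h2 hμ)
  have hcard : ∀ ν : YoungDiagram, ν ≤ μ → ∀ h,
      (-1 : R) ^ (μ.card - ν.card) +
        (-1) ^ (μ.card - (⟨symmDiff ν.cells {(i, j)}, h⟩ : YoungDiagram).card) = 0 := by
    intro ν hν h
    have hle' : symmDiff ν.cells {(i, j)} ≤ μ.cells := by
      intro c hc
      rcases (hmem ν c).1 hc with ⟨-, hc⟩ | ⟨rfl, -⟩
      exacts [hν hc, hμ]
    have h1 := Finset.card_le_card hle'
    have h2 := card_le_card hν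
    by_cases hc : (i, j) ∈ ν
    · have h3 : symmDiff ν.cells {(i, j)} = ν.cells.erase (i, j) := by
        ext c
        rw [hmem, Finset.mem_erase, mem_cells]
        exact ⟨fun h => h.elim id fun h => absurd hc h.2, Or.inl⟩
      have h4 := Finset.card_erase_add_one (s := ν.cells) (a := (i, j)) hc
      simp only [YoungDiagram.card, h3] at h1 h2 h4 ⊢
      rw [show μ.cells.card - (ν.cells.erase (i, j)).card = μ.cells.card - ν.cells.card + 1 by
        omega, pow_succ]
      ring
    · have h3 : symmDiff ν.cells {(i, j)} = insert (i, j) ν.cells := by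
        ext c
        rw [hmem, Finset.mem_insert, mem_cells]
        by_cases h : c = (i, j)
        · simp [h, hc]
        · simp [h]
      have h4 := Finset.card_insert_of_notMem (s := ν.cells) (a := (i, j)) hc
      simp only [YoungDiagram.card, h3] at h1 h2 h4 ⊢
      rw [show μ.cells.card - ν.cells.card =
        μ.cells.card - (insert (i, j) ν.cells).card + 1 by omega, pow_succ]
      ring
  refine Finset.sum_involution (fun ν hν => ⟨symmDiff ν.cells {(i, j)}, hlow ν hν⟩) ?_ ?_ ?_ ?_
  · intro ν hν
    exact hcard ν (mem_subdiagrams.1 (Finset.mem_filter.1 hν).1) _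
  · intro ν hν _ h
    have h1 := congrArg cells h
    simp at h1
  · intro ν hν
    have hν' := hν
    simp only [Finset.mem_filter, mem_subdiagrams] at hν'
    obtain ⟨-, ⟨hνμ, hv⟩, hκν, hh⟩ := hν'
    have hmem' : ∀ c, c ∈ (⟨symmDiff ν.cells {(i, j)}, hlow ν hν⟩ : YoungDiagram) ↔
        (c ≠ (i, j) ∧ c ∈ ν) ∨ (c = (i, j) ∧ (i, j) ∉ ν) := hmem ν
    have hle' : (⟨symmDiff ν.cells {(i, j)}, hlow ν hν⟩ : YoungDiagram) ≤ μ := by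
      intro c hc
      rcases (hmem ν c).1 hc with ⟨-, hc⟩ | ⟨rfl, -⟩
      exacts [hνμ hc, hμ]
    simp only [Finset.mem_filter, mem_subdiagrams]
    refine ⟨hle', ⟨hle', fun a b b' hb hm => ?_⟩, fun c hc => ?_, fun a a' b ha hm => ?_⟩
    · rw [hmem']
      refine Or.inl ⟨fun h => ?_, hv a b b' hb hm⟩
      obtain ⟨rfl, rfl⟩ := Prod.mk.inj h
      exact hrow _ hb hm
    · exact (hmem' c).2 (Or.inl ⟨fun h => hκc (h ▸ hc), hκν hc⟩)
    · rcases (hmem' _).1 hm with ⟨-, hm⟩ | ⟨hm, -⟩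
      · exact hh _ _ _ ha hm
      · obtain ⟨rfl, rfl⟩ := Prod.mk.inj hm
        exact hcol _ ha
  · intro ν hν
    exact YoungDiagram.ext (symmDiff_symmDiff_cancel_right _ _)

end YoungDiagram

/-! ### The branching rule for signed tableaux -/

namespace SignedTableau

/-- The condition on the cells of `μ / ν` to be filled with a letter `l` that is greater than all
entries in `ν`: they form a horizontal strip if `l` is positive, a vertical strip if it is
negative. -/
def IsStrip {α β : Type*} (l : β ⊕ₗ α) (ν μ : YoungDiagram) : Prop :=
  Sum.elim (fun _ => ν.IsVerticalStrip μ) (fun _ => ν.IsHorizontalStrip μ) (ofLex l)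

theorem IsStrip.le {α β : Type*} {l : β ⊕ₗ α} {ν μ : YoungDiagram} (h : IsStrip l ν μ) : ν ≤ μ := by
  rcases l with b | a
  exacts [h.1, h.1]

variable {α β : Type*} [LinearOrder α] [LinearOrder β] {μ ν : YoungDiagram}

theorem entry_injective : Function.Injective (entry : SignedTableau α β μ → μ.cells → β ⊕ₗ α) := by
  rintro ⟨e, _, _, _, _⟩ ⟨e', _, _, _, _⟩ h
  cases h
  rfl

theorem entry_mono (T : SignedTableau α β μ) (c d : μ.cells) (h1 : c.1.1 ≤ d.1.1)
    (h2 : c.1.2 ≤ d.1.2) : T.entry c ≤ T.entry d := by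
  have hm : (c.1.1, d.1.2) ∈ μ.cells := μ.up_left_mem h1 le_rfl d.2
  calc T.entry c ≤ T.entry ⟨(c.1.1, d.1.2), hm⟩ := by
        rcases eq_or_lt_of_le h2 with h | h
        · exact le_of_eq (congrArg _ (Subtype.ext (Prod.ext rfl h)))
        · exact T.row_weak _ _ rfl h
    _ ≤ T.entry d := by
        rcases eq_or_lt_of_le h1 with h | h
        · exact le_of_eq (congrArg _ (Subtype.ext (Prod.ext h rfl)))
        · exact T.col_weak _ _ rfl h

theorem finite_setOf_entry_mem (S : Finset (β ⊕ₗ α)) (μ : YoungDiagram) :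
    {T : SignedTableau α β μ | ∀ c, T.entry c ∈ S}.Finite :=
  Set.Finite.of_finite_image (f := entry)
    ((Set.Finite.pi' fun _ : μ.cells => S.finite_toSet).subset (by
      rintro _ ⟨T, hT, rfl⟩
      exact hT))
    entry_injective.injOn

/-- The finite set of the signed tableaux of shape `μ` with all entries in `S`. -/
def tableauxIn (S : Finset (β ⊕ₗ α)) (μ : YoungDiagram) : Finset (SignedTableau α β μ) :=
  (finite_setOf_entry_mem S μ).toFinset

@[simp]
theorem mem_tableauxIn {S : Finset (β ⊕ₗ α)} {T : SignedTableau α β μ} :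
    T ∈ tableauxIn S μ ↔ ∀ c, T.entry c ∈ S := by
  simp [tableauxIn]

/-- The diagram formed by the entries less than `l`. -/
def shapeLT (T : SignedTableau α β μ) (l : β ⊕ₗ α) : YoungDiagram where
  cells := {c ∈ μ.cells | ∀ h : c ∈ μ.cells, T.entry ⟨c, h⟩ < l}
  isLowerSet := by
    intro c d hdc hc
    simp only [Finset.coe_filter, Set.mem_ofPred_eq] at hc ⊢
    have hd : d ∈ μ.cells := μ.isLowerSet hdc hc.1
    exact ⟨hd, fun _ => (T.entry_mono ⟨d, hd⟩ ⟨c, hc.1⟩ hdc.1 hdc.2).trans_lt (hc.2 hc.1)⟩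

theorem mem_shapeLT {T : SignedTableau α β μ} {l : β ⊕ₗ α} {c : ℕ × ℕ} (h : c ∈ μ.cells) :
    c ∈ T.shapeLT l ↔ T.entry ⟨c, h⟩ < l := by
  rw [← YoungDiagram.mem_cells, shapeLT, Finset.mem_filter]
  exact ⟨fun hc => hc.2 h, fun hc => ⟨h, fun _ => hc⟩⟩

theorem shapeLT_le (T : SignedTableau α β μ) (l : β ⊕ₗ α) : T.shapeLT l ≤ μ :=
  Finset.filter_subset _ _

theorem isStrip_shapeLT (T : SignedTableau α β μ) {l : β ⊕ₗ α} (hT : ∀ c, T.entry c ≤ l) :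
    IsStrip l (T.shapeLT l) μ := by
  obtain ⟨l, rfl⟩ := toLex.surjective l
  rcases l with b | a
  · refine ⟨T.shapeLT_le _, fun i j j' hj hm => ?_⟩
    have hm' : (i, j) ∈ μ.cells := μ.up_left_mem le_rfl hj.le hm
    rw [mem_shapeLT hm']
    refine lt_of_le_of_ne (hT _) fun he => ?_
    have h2 := le_antisymm (hT ⟨(i, j'), hm⟩) (he ▸ T.row_weak ⟨(i, j), hm'⟩ ⟨(i, j'), hm⟩ rfl hj)
    exact lt_irrefl _ (T.neg_row_strict ⟨(i, j), hm'⟩ ⟨(i, j'), hm⟩ rfl hj b b he h2)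
  · refine ⟨T.shapeLT_le _, fun i i' j hi hm => ?_⟩
    have hm' : (i, j) ∈ μ.cells := μ.up_left_mem hi.le le_rfl hm
    rw [mem_shapeLT hm']
    refine lt_of_le_of_ne (hT _) fun he => ?_
    have h2 := le_antisymm (hT ⟨(i', j), hm⟩) (he ▸ T.col_weak ⟨(i, j), hm'⟩ ⟨(i', j), hm⟩ rfl hi)
    exact lt_irrefl _ (T.pos_col_strict ⟨(i, j), hm'⟩ ⟨(i', j), hm⟩ rfl hi a a he h2)

/-- The restriction of a signed tableau to a smaller diagram. -/
def restrict (T : SignedTableau α β μ) (h : ν ≤ μ) : SignedTableau α β ν where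
  entry c := T.entry ⟨c.1, h c.2⟩
  row_weak c d := T.row_weak ⟨c.1, h c.2⟩ ⟨d.1, h d.2⟩
  col_weak c d := T.col_weak ⟨c.1, h c.2⟩ ⟨d.1, h d.2⟩
  pos_col_strict c d := T.pos_col_strict ⟨c.1, h c.2⟩ ⟨d.1, h d.2⟩
  neg_row_strict c d := T.neg_row_strict ⟨c.1, h c.2⟩ ⟨d.1, h d.2⟩

/-- The tableau of shape `μ` obtained by filling the strip `μ / ν` with the letter `l`. -/
def extend (T : SignedTableau α β ν) (l : β ⊕ₗ α) (hT : ∀ c, T.entry c < l)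
    (h : IsStrip l ν μ) : SignedTableau α β μ where
  entry c := if hc : c.1 ∈ ν.cells then T.entry ⟨c.1, hc⟩ else l
  row_weak c d h1 h2 := by
    by_cases hd : d.1 ∈ ν.cells
    · have hc : c.1 ∈ ν.cells := ν.up_left_mem h1.le h2.le hd
      rw [dif_pos hc, dif_pos hd]
      exact T.row_weak _ _ h1 h2
    · rw [dif_neg hd]
      split_ifs
      exacts [(hT _).le, le_rfl]
  col_weak c d h1 h2 := by
    by_cases hd : d.1 ∈ ν.cells
    · have hc : c.1 ∈ ν.cells := ν.up_left_mem h2.le h1.le hd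
      rw [dif_pos hc, dif_pos hd]
      exact T.col_weak _ _ h1 h2
    · rw [dif_neg hd]
      split_ifs
      exacts [(hT _).le, le_rfl]
  pos_col_strict c d h1 h2 a a' := by
    by_cases hd : d.1 ∈ ν.cells
    · have hc : c.1 ∈ ν.cells := ν.up_left_mem h2.le h1.le hd
      rw [dif_pos hc, dif_pos hd]
      exact T.pos_col_strict _ _ h1 h2 a a'
    · rw [dif_neg hd]
      rintro h3 rfl
      have hc : c.1 ∈ ν.cells := by
        have := h.2 c.1.1 d.1.1 c.1.2 h2 (by rw [h1]; exact d.2)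
        exact this
      rw [dif_pos hc] at h3
      have := hT ⟨c.1, hc⟩
      rw [h3] at this
      exact Sum.Lex.inr_lt_inr_iff.1 this
  neg_row_strict c d h1 h2 b b' := by
    by_cases hd : d.1 ∈ ν.cells
    · have hc : c.1 ∈ ν.cells := ν.up_left_mem h1.le h2.le hd
      rw [dif_pos hc, dif_pos hd]
      exact T.neg_row_strict _ _ h1 h2 b b'
    · rw [dif_neg hd]
      rintro h3 rfl
      have hc : c.1 ∈ ν.cells := by
        have := h.2 c.1.1 c.1.2 d.1.2 h2 (by rw [h1]; exact d.2)
        exact this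
      rw [dif_pos hc] at h3
      have := hT ⟨c.1, hc⟩
      rw [h3] at this
      exact Sum.Lex.inl_lt_inl_iff.1 this

theorem extend_entry_of_mem (T : SignedTableau α β ν) {l : β ⊕ₗ α} (hT : ∀ c, T.entry c < l)
    (h : IsStrip l ν μ) (c : μ.cells) (hc : c.1 ∈ ν.cells) :
    (T.extend l hT h).entry c = T.entry ⟨c.1, hc⟩ := dif_pos hc

theorem extend_entry_of_notMem (T : SignedTableau α β ν) {l : β ⊕ₗ α} (hT : ∀ c, T.entry c < l)
    (h : IsStrip l ν μ) (c : μ.cells) (hc : c.1 ∉ ν.cells) :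
    (T.extend l hT h).entry c = l := dif_neg hc

theorem prod_entry {R : Type*} [CommMonoid R] (w : β ⊕ₗ α → R) (T : SignedTableau α β μ)
    (hν : ν ≤ μ) (l : β ⊕ₗ α) (hT : ∀ c : μ.cells, c.1 ∉ ν.cells → T.entry c = l) :
    ∏ c, w (T.entry c) = w l ^ (μ.card - ν.card) * ∏ c, w ((T.restrict hν).entry c) := by
  classical
  let e : ℕ × ℕ → R := fun c => if h : c ∈ μ.cells then w (T.entry ⟨c, h⟩) else 1
  have h1 : ∏ c, w (T.entry c) = ∏ c ∈ μ.cells, e c := by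
    rw [← Finset.prod_coe_sort μ.cells e]
    exact Finset.prod_congr rfl fun c _ => by simp [e]
  have h2 : ∏ c, w ((T.restrict hν).entry c) = ∏ c ∈ ν.cells, e c := by
    rw [← Finset.prod_coe_sort ν.cells e]
    refine Finset.prod_congr rfl fun c _ => ?_
    have : c.1 ∈ μ.cells := hν c.2
    simp only [e, dif_pos this]
    rfl
  rw [h1, h2, ← Finset.prod_sdiff (show ν.cells ⊆ μ.cells from hν), Finset.prod_congr rfl
    (g := fun _ => w l), Finset.prod_const, Finset.card_sdiff_of_subset hν]
  intro c hc
  obtain ⟨hc1, hc2⟩ := Finset.mem_sdiff.1 hc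
  simp only [e, dif_pos hc1, hT ⟨c, hc1⟩ hc2]

open Classical in
/-- The branching rule for signed tableaux: removing the cells with the greatest letter `l` leaves
a tableau of shape `ν`, and the removed cells form an arbitrary strip of the kind given by the sign
of `l`. -/
theorem sum_tableauxIn_insert {R : Type*} [CommSemiring R] [DecidableEq (β ⊕ₗ α)]
    (w : β ⊕ₗ α → R) (S : Finset (β ⊕ₗ α)) (l : β ⊕ₗ α) (hl : ∀ x ∈ S, x < l) (μ : YoungDiagram) :
    ∑ T ∈ tableauxIn (insert l S) μ, ∏ c, w (T.entry c) =
      ∑ ν ∈ μ.subdiagrams with IsStrip l ν μ, w l ^ (μ.card - ν.card) *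
        ∑ T ∈ tableauxIn S ν, ∏ c, w (T.entry c) := by
  have hle : ∀ T ∈ tableauxIn (insert l S) μ, ∀ c, T.entry c ≤ l := by
    intro T hT c
    rcases Finset.mem_insert.1 (mem_tableauxIn.1 hT c) with h | h
    exacts [h.le, (hl _ h).le]
  rw [← Finset.sum_fiberwise_of_maps_to (g := fun T => T.shapeLT l)
    (t := μ.subdiagrams.filter fun ν => IsStrip l ν μ)]
  swap
  · intro T hT
    exact Finset.mem_filter.2 ⟨YoungDiagram.mem_subdiagrams.2 (T.shapeLT_le l),
      T.isStrip_shapeLT (hle T hT)⟩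
  refine Finset.sum_congr rfl fun ν hν => ?_
  have hs := (Finset.mem_filter.1 hν).2
  have hT' : ∀ T ∈ tableauxIn S ν, ∀ c, T.entry c < l :=
    fun T hT c => hl _ (mem_tableauxIn.1 hT c)
  have hnot : ∀ T ∈ tableauxIn (insert l S) μ, T.shapeLT l = ν →
      ∀ c : μ.cells, c.1 ∉ ν.cells → T.entry c = l := by
    intro T hT hTν c hc
    refine le_antisymm (hle T hT c) (not_lt.1 fun h => hc ?_)
    rw [← hTν]
    exact (mem_shapeLT c.2).2 h
  rw [Finset.mul_sum]
  refine Finset.sum_bij' (fun T _ => T.restrict hs.le) (fun T hT => T.extend l (hT' T hT) hs)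
    ?_ ?_ ?_ ?_ ?_
  · intro T hT
    obtain ⟨hT, hTν⟩ := Finset.mem_filter.1 hT
    rw [mem_tableauxIn]
    intro c
    have h1 : T.entry ⟨c.1, hs.le c.2⟩ < l := (mem_shapeLT _).1 (hTν ▸ c.2)
    exact Finset.mem_of_mem_insert_of_ne (mem_tableauxIn.1 hT _) h1.ne
  · intro T hT
    rw [Finset.mem_filter, mem_tableauxIn]
    constructor
    · intro c
      by_cases hc : c.1 ∈ ν.cells
      · rw [extend_entry_of_mem _ _ _ _ hc]
        exact Finset.mem_insert_of_mem (mem_tableauxIn.1 hT _)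
      · rw [extend_entry_of_notMem _ _ _ _ hc]
        exact Finset.mem_insert_self _ _
    · ext c
      by_cases hcμ : c ∈ μ.cells
      · rw [YoungDiagram.mem_cells, mem_shapeLT hcμ]
        by_cases hc : c ∈ ν.cells
        · rw [extend_entry_of_mem _ _ _ _ hc]
          exact ⟨fun _ => hc, fun _ => hT' T hT _⟩
        · rw [extend_entry_of_notMem _ _ _ _ hc]
          exact ⟨fun h => absurd h (lt_irrefl _), fun h => absurd h hc⟩
      · exact ⟨fun h => absurd (shapeLT_le _ _ h) hcμ, fun h => absurd (hs.le h) hcμ⟩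
  · intro T hT
    obtain ⟨hT, hTν⟩ := Finset.mem_filter.1 hT
    refine entry_injective (funext fun c => ?_)
    by_cases hc : c.1 ∈ ν.cells
    · rw [extend_entry_of_mem _ _ _ _ hc]
      rfl
    · rw [extend_entry_of_notMem _ _ _ _ hc, hnot T hT hTν c hc]
  · intro T hT
    refine entry_injective (funext fun c => ?_)
    exact extend_entry_of_mem T (hT' T hT) hs ⟨c.1, hs.le c.2⟩ c.2
  · intro T hT
    obtain ⟨hT, hTν⟩ := Finset.mem_filter.1 hT
    exact prod_entry w T hs.le l (hnot T hT hTν)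

/-- There are no cells to fill without letters, except in the empty diagram. -/
theorem sum_tableauxIn_empty {R : Type*} [CommSemiring R] (w : β ⊕ₗ α → R) (μ : YoungDiagram)
    [Decidable (μ = ⊥)] :
    ∑ T ∈ tableauxIn ∅ μ, ∏ c, w (T.entry c) = if μ = ⊥ then 1 else 0 := by
  split_ifs with h
  · subst h
    have he : IsEmpty (⊥ : YoungDiagram).cells := ⟨fun c => Finset.notMem_empty _ c.2⟩
    let T₀ : SignedTableau α β ⊥ :=
      ⟨fun c => he.elim c, fun c => he.elim c, fun c => he.elim c, fun c => he.elim c,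
        fun c => he.elim c⟩
    have : tableauxIn (∅ : Finset (β ⊕ₗ α)) ⊥ = {T₀} := by
      ext T
      simp only [mem_tableauxIn, Finset.mem_singleton]
      exact ⟨fun _ => entry_injective (funext fun c => he.elim c), fun _ c => he.elim c⟩
    rw [this, Finset.sum_singleton, Finset.prod_of_isEmpty]
  · refine Finset.sum_eq_zero fun T hT => absurd ?_ h
    refine YoungDiagram.ext (Finset.eq_empty_of_forall_notMem fun c hc => ?_)
    simpa using mem_tableauxIn.1 hT ⟨c, hc⟩

end SignedTableau

/-! ### Semistandard tableaux as signed tableaux -/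

theorem prod_X_eq_monomial {σ ι : Type*} (s : Finset ι) (v : ι → σ) :
    ∏ c ∈ s, (X (v c) : MvPowerSeries σ ℚ) = monomial (∑ c ∈ s, Finsupp.single (v c) 1) 1 := by
  classical
  induction s using Finset.induction_on with
  | empty => simp
  | insert a s ha ih =>
    rw [Finset.prod_insert ha, Finset.sum_insert ha, ih, X_def, monomial_mul_monomial, one_mul]

namespace SemistandardYoungTableau

variable {μ : YoungDiagram}

/-- The index of a letter of an alphabet with positive letters only. -/
def letterIndex (l : Empty ⊕ₗ ℕ) : ℕ := Sum.elim Empty.elim id (ofLex l)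

@[simp]
theorem letterIndex_inr (n : ℕ) : letterIndex (Sum.inrₗ n) = n := rfl

@[simp]
theorem inr_letterIndex (l : Empty ⊕ₗ ℕ) : Sum.inrₗ (letterIndex l) = l := by
  obtain ⟨l, rfl⟩ := toLex.surjective l
  rcases l with b | n
  exacts [b.elim, rfl]

theorem letterIndex_mono {l l' : Empty ⊕ₗ ℕ} (h : l ≤ l') : letterIndex l ≤ letterIndex l' := by
  rw [← inr_letterIndex l, ← inr_letterIndex l'] at h
  exact Sum.Lex.inr_le_inr_iff.1 h

/-- Semistandard tableaux are the signed tableaux for the alphabet of the natural numbers, all of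
them positive. -/
def equivSigned (μ : YoungDiagram) : SemistandardYoungTableau μ ≃ SignedTableau ℕ Empty μ where
  toFun T :=
    { entry := fun c => Sum.inrₗ (T c.1.1 c.1.2)
      row_weak := fun c d h1 h2 => Sum.Lex.inr_le_inr_iff.2 (by
        have := T.row_weak h2 (show (c.1.1, d.1.2) ∈ μ by rw [h1]; exact d.2)
        rwa [h1] at this ⊢)
      col_weak := fun c d h1 h2 => Sum.Lex.inr_le_inr_iff.2 (by
        have := T.col_strict h2 (show (d.1.1, c.1.2) ∈ μ by rw [h1]; exact d.2)
        rw [h1] at this ⊢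
        exact this.le)
      pos_col_strict := by
        rintro c d h1 h2 a a' ha ha'
        have := T.col_strict h2 (show (d.1.1, c.1.2) ∈ μ by rw [h1]; exact d.2)
        obtain rfl : T c.1.1 c.1.2 = a := congrArg letterIndex ha
        obtain rfl : T d.1.1 d.1.2 = a' := congrArg letterIndex ha'
        rwa [h1] at this ⊢
      neg_row_strict := fun _ _ _ _ b => b.elim }
  invFun T :=
    { entry := fun i j => if h : (i, j) ∈ μ.cells then letterIndex (T.entry ⟨(i, j), h⟩) else 0
      row_weak' := by
        intro i j j' hj hm
        have hm' : (i, j) ∈ μ.cells := μ.up_left_mem le_rfl hj.le hm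
        rw [dif_pos hm', dif_pos (show (i, j') ∈ μ.cells from hm)]
        exact letterIndex_mono (T.row_weak _ _ rfl hj)
      col_strict' := by
        intro i i' j hi hm
        have hm' : (i, j) ∈ μ.cells := μ.up_left_mem hi.le le_rfl hm
        rw [dif_pos hm', dif_pos (show (i', j) ∈ μ.cells from hm)]
        exact T.pos_col_strict ⟨(i, j), hm'⟩ ⟨(i', j), hm⟩ rfl hi _ _
          (inr_letterIndex _).symm (inr_letterIndex _).symm
      zeros' := fun h => dif_neg h }
  left_inv T := by
    refine SemistandardYoungTableau.ext fun i j => ?_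
    change (if h : (i, j) ∈ μ.cells then letterIndex (Sum.inrₗ (T i j)) else 0) = T i j
    split_ifs with h
    exacts [rfl, (T.zeros h).symm]
  right_inv T := by
    refine SignedTableau.entry_injective (funext fun c => ?_)
    change Sum.inrₗ (if h : c.1 ∈ μ.cells then letterIndex (T.entry ⟨c.1, h⟩) else 0) = T.entry c
    rw [dif_pos c.2, inr_letterIndex]

theorem content_eq_sum (T : SemistandardYoungTableau μ) :
    T.content = ∑ c, Finsupp.single (letterIndex ((equivSigned μ T).entry c)) 1 :=
  (Finset.sum_coe_sort μ.cells fun c => Finsupp.single (T c.1 c.2) 1).symm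

/-- The positive letters with index less than `n`. -/
def lettersLT (n : ℕ) : Finset (Empty ⊕ₗ ℕ) := (Finset.range n).image Sum.inrₗ

theorem mem_lettersLT {n : ℕ} {l : Empty ⊕ₗ ℕ} : l ∈ lettersLT n ↔ letterIndex l < n := by
  rw [lettersLT, Finset.mem_image]
  constructor
  · rintro ⟨i, hi, rfl⟩
    exact Finset.mem_range.1 hi
  · exact fun h => ⟨letterIndex l, Finset.mem_range.2 h, inr_letterIndex l⟩

theorem lettersLT_succ (n : ℕ) : lettersLT (n + 1) = insert (Sum.inrₗ n) (lettersLT n) := by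
  rw [lettersLT, Finset.range_add_one, Finset.image_insert, lettersLT]

/-- The Schur function in the variables `x_i`, `i < n`, is the generating function of the tableaux
with entries less than `n`. -/
theorem restrictVars_schurSeries (μ : YoungDiagram) (n : ℕ) :
    restrictVars (Set.Iio n) (schurSeries μ) =
      ∑ T ∈ SignedTableau.tableauxIn (lettersLT n) μ, ∏ c, X (letterIndex (T.entry c)) := by
  classical
  ext m
  have hsum : coeff m (∑ T ∈ SignedTableau.tableauxIn (lettersLT n) μ,
      ∏ c, (X (letterIndex (T.entry c)) : MvPowerSeries ℕ ℚ)) =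
      (((SignedTableau.tableauxIn (lettersLT n) μ).filter fun T =>
        ∑ c, Finsupp.single (letterIndex (T.entry c)) 1 = m).card : ℚ) := by
    rw [map_sum, Finset.card_filter, Nat.cast_sum]
    refine Finset.sum_congr rfl fun T _ => ?_
    rw [prod_X_eq_monomial, coeff_monomial]
    simp only [eq_comm (a := m)]
    split_ifs <;> simp
  have hsupp : ∀ (T : SignedTableau ℕ Empty μ) (c : μ.cells), letterIndex (T.entry c) ∈
      (∑ c, Finsupp.single (letterIndex (T.entry c)) 1 : ℕ →₀ ℕ).support := by
    intro T c
    rw [Finsupp.mem_support_iff, Finsupp.finsetSum_apply]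
    refine (Finset.sum_pos' (fun _ _ => Nat.zero_le _) ⟨c, Finset.mem_univ c, ?_⟩).ne'
    simp
  rw [hsum, coeff_restrictVars]
  split_ifs with h
  · rw [coeff_schurSeries, ← Fintype.card_coe, ← Nat.card_eq_fintype_card]
    refine congrArg _ (Nat.card_congr ((equivSigned μ).subtypeEquiv fun T => ?_))
    rw [Finset.mem_filter, SignedTableau.mem_tableauxIn, content_eq_sum]
    refine ⟨fun hm => ⟨fun c => mem_lettersLT.2 (h ?_), hm⟩, fun hm => hm.2⟩
    rw [← hm]
    exact hsupp _ c
  · symm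
    rw [Nat.cast_eq_zero, Finset.card_eq_zero, Finset.filter_eq_empty_iff]
    rintro T hT rfl
    refine h fun i hi => ?_
    obtain ⟨c, -, hc⟩ := Finset.exists_ne_zero_of_sum_ne_zero (by
      rwa [Finset.mem_coe, Finsupp.mem_support_iff, Finsupp.finsetSum_apply] at hi)
    obtain rfl : letterIndex (T.entry c) = i := by
      by_contra hne
      exact hc (Finsupp.single_eq_of_ne (Ne.symm hne))
    exact mem_lettersLT.1 (SignedTableau.mem_tableauxIn.1 hT c)

open Classical in
theorem restrictVars_schurSeries_succ (μ : YoungDiagram) (n : ℕ) :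
    restrictVars (Set.Iio (n + 1)) (schurSeries μ) =
      ∑ ν ∈ μ.subdiagrams with ν.IsHorizontalStrip μ,
        X n ^ (μ.card - ν.card) * restrictVars (Set.Iio n) (schurSeries ν) := by
  simp only [restrictVars_schurSeries]
  rw [lettersLT_succ]
  have hlt : ∀ l ∈ lettersLT n, l < Sum.inrₗ n := fun l hl => by
    rw [← inr_letterIndex l]
    exact Sum.Lex.inr_lt_inr_iff.2 (mem_lettersLT.1 hl)
  rw [SignedTableau.sum_tableauxIn_insert
    (fun l => (X (letterIndex l) : MvPowerSeries ℕ ℚ)) _ _ hlt μ]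
  exact Finset.sum_congr (Finset.filter_congr fun ν _ => Iff.rfl) fun ν _ => by
    rw [letterIndex_inr]

end SemistandardYoungTableau

/-! ### Branching rules for specialized Schur functions -/

namespace SymFun

/-- The morphism `f t ^ j ↦ f(x_0, …, x_{n-1}) x_n ^ j` from `Sym[t]` to power series. -/
def evalTop (n : ℕ) : Polynomial SymFun →ₐ[ℚ] MvPowerSeries ℕ ℚ :=
  Polynomial.aevalTower ((restrictVars (Set.Iio n)).comp SymFun.val) (X n)

theorem evalTop_C_mul_X_pow (n k : ℕ) (f : SymFun) :
    evalTop n (Polynomial.C f * Polynomial.X ^ k) = restrictVars (Set.Iio n) f.1 * X n ^ k := by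
  rw [evalTop, map_mul, map_pow, Polynomial.aevalTower_C, Polynomial.aevalTower_X]
  rfl

theorem coeff_evalTop (n k : ℕ) (F : Polynomial SymFun) (m : ℕ →₀ ℕ)
    (hm : (m.support : Set ℕ) ⊆ Set.Iio n) :
    coeff (m + Finsupp.single n k) (evalTop n F) = coeff m (F.coeff k).1 := by
  classical
  have hmn : m n = 0 := by
    by_contra h
    exact lt_irrefl n (hm (Finsupp.mem_support_iff.2 h))
  induction F using Polynomial.induction_on' with
  | add F G hF hG => rw [map_add, map_add, hF, hG, Polynomial.coeff_add]; simp
  | monomial j f =>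
    rw [← Polynomial.C_mul_X_pow_eq_monomial, evalTop_C_mul_X_pow, Polynomial.coeff_C_mul_X_pow,
      X_pow_eq, coeff_mul_monomial, mul_one]
    by_cases hjk : k = j
    · subst hjk
      rw [if_pos (by simp), if_pos rfl, add_tsub_cancel_right, coeff_restrictVars_of_subset _ hm]
    · rw [if_neg hjk]
      split_ifs with hle
      · refine coeff_restrictVars_of_not_subset _ fun hs => lt_irrefl n (hs ?_)
        have := hle n
        simp only [Finsupp.single_eq_same, Finsupp.add_apply, hmn] at this
        simp only [Finset.mem_coe, Finsupp.mem_support_iff, Finsupp.tsub_apply, Finsupp.add_apply,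
          Finsupp.single_eq_same, hmn]
        omega
      · simp

/-- The morphisms `evalTop n` are jointly injective: by `coeff_evalTop`, every coefficient of `F` can
be read off from `evalTop n F` for large `n`. -/
theorem eq_of_evalTop_eq (F G : Polynomial SymFun) (h : ∀ n, evalTop n F = evalTop n G) :
    F = G := by
  refine Polynomial.ext fun k => Subtype.ext (MvPowerSeries.ext fun m => ?_)
  have hm : (m.support : Set ℕ) ⊆ Set.Iio (m.support.sup id + 1) :=
    fun i hi => Nat.lt_succ_of_le (Finset.le_sup (f := id) hi)
  rw [← coeff_evalTop _ k F m hm, ← coeff_evalTop _ k G m hm, h]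

theorem restrictVars_p (n : ℕ) {k : ℕ} (hk : k ≠ 0) :
    restrictVars (Set.Iio n) (p k).1 = ∑ i ∈ Finset.range n, X i ^ k := by
  classical
  rw [← Finset.coe_range, restrictVars_powerSum _ (fun _ => True) hk]
  · simp
  · intro m
    simp [p, coeff_powerSum]

/-- The substitution `p_k ↦ p_k + t ^ k`, which adds one variable `t` to the alphabet. -/
def addVar : SymFun →ₐ[ℚ] Polynomial SymFun :=
  specialize fun k => Polynomial.C (p k) + Polynomial.X ^ k

/-- Restricting `addVar f` to `n` variables and taking `t = x_n` gives `f(x_0, …, x_n)`. -/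
theorem evalTop_addVar (n : ℕ) (f : SymFun) :
    evalTop n (addVar f) = restrictVars (Set.Iio (n + 1)) f.1 := by
  refine (map_specialize (R := Polynomial SymFun) (R' := MvPowerSeries ℕ ℚ) _ (evalTop n) f).trans ?_
  refine (DFunLike.congr_fun (eq_specialize _
    ((restrictVars (Set.Iio (n + 1))).comp SymFun.val) fun k hk => ?_) f).symm
  have h1 := evalTop_C_mul_X_pow n 0 (p k)
  have h2 := evalTop_C_mul_X_pow n k 1
  simp only [pow_zero, mul_one, map_one, one_mul, OneMemClass.coe_one] at h1 h2
  rw [map_add, h1, h2, restrictVars_p n hk, ← Finset.sum_range_succ]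
  exact restrictVars_p (n + 1) hk

open Classical in
theorem addVar_schur (μ : YoungDiagram) : addVar (schur μ) =
    ∑ ν ∈ μ.subdiagrams with ν.IsHorizontalStrip μ,
      Polynomial.C (schur ν) * Polynomial.X ^ (μ.card - ν.card) := by
  refine eq_of_evalTop_eq _ _ fun n => ?_
  rw [evalTop_addVar, map_sum]
  simp only [evalTop_C_mul_X_pow]
  refine (SemistandardYoungTableau.restrictVars_schurSeries_succ μ n).trans ?_
  exact Finset.sum_congr rfl fun ν _ => mul_comm _ _

open Classical in
/-- The branching rule for a positive letter: the universal identity `addVar_schur`, evaluated at the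
virtual alphabet `a` and at `t = x`. -/
theorem specialize_add_schur {R : Type*} [CommRing R] [Algebra ℚ R] (a : ℕ → R) (x : R)
    (μ : YoungDiagram) : specialize (fun k => a k + x ^ k) (schur μ) =
      ∑ ν ∈ μ.subdiagrams with ν.IsHorizontalStrip μ,
        x ^ (μ.card - ν.card) * specialize a (schur ν) := by
  let ev : Polynomial SymFun →ₐ[ℚ] R := Polynomial.aevalTower (specialize a) x
  have hC : ∀ f, ev (Polynomial.C f) = specialize a f := Polynomial.aevalTower_C _ _
  have hX : ev Polynomial.X = x := Polynomial.aevalTower_X _ _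
  have h := congrArg ev (addVar_schur μ)
  replace h := (map_specialize (R := Polynomial SymFun) _ ev (schur μ)).symm.trans h
  rw [map_sum] at h
  rw [specialize_congr (a' := fun k => ev (Polynomial.C (p k) + Polynomial.X ^ k)), h]
  · refine Finset.sum_congr rfl fun ν _ => ?_
    rw [map_mul, map_pow, hC, hX, mul_comm]
  · intro k hk
    rw [map_add, map_pow, hC, hX, specialize_p a k hk]

open Classical in
/-- The branching rule for a negative letter. Removing a letter `-y` from `A - y` is undone by adding
`y`, so the rule is the inverse of the one for a positive letter, given by
`YoungDiagram.sum_strips`. -/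
theorem specialize_sub_schur {R : Type*} [CommRing R] [Algebra ℚ R] (a : ℕ → R) (y : R)
    (μ : YoungDiagram) : specialize (fun k => a k - y ^ k) (schur μ) =
      ∑ ν ∈ μ.subdiagrams with ν.IsVerticalStrip μ,
        (-y) ^ (μ.card - ν.card) * specialize a (schur ν) := by
  set b : ℕ → R := fun k => a k - y ^ k with hb
  have hadd : ∀ ν ∈ μ.subdiagrams, specialize a (schur ν) =
      ∑ κ ∈ μ.subdiagrams, if κ.IsHorizontalStrip ν then
        y ^ (ν.card - κ.card) * specialize b (schur κ) else 0 := by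
    intro ν hν
    have hab : a = fun k => b k + y ^ k := funext fun k => by simp [hb]
    rw [hab, specialize_add_schur, ← Finset.sum_filter]
    refine Finset.sum_congr (Finset.ext fun κ => ?_) fun _ _ => rfl
    simp only [Finset.mem_filter, YoungDiagram.mem_subdiagrams] at hν ⊢
    exact ⟨fun h => ⟨h.1.trans hν, h.2⟩, fun h => ⟨h.2.1, h.2⟩⟩
  have hterm : ∀ κ ν : YoungDiagram, (if ν.IsVerticalStrip μ then (-y) ^ (μ.card - ν.card) *
        (if κ.IsHorizontalStrip ν then y ^ (ν.card - κ.card) * specialize b (schur κ) else 0)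
        else 0) =
      y ^ (μ.card - κ.card) * specialize b (schur κ) *
        if ν.IsVerticalStrip μ ∧ κ.IsHorizontalStrip ν then (-1) ^ (μ.card - ν.card) else 0 := by
    intro κ ν
    by_cases h1 : ν.IsVerticalStrip μ
    · by_cases h2 : κ.IsHorizontalStrip ν
      · rw [if_pos h1, if_pos h2, if_pos ⟨h1, h2⟩]
        have h3 := YoungDiagram.card_le_card h1.1
        have h4 := YoungDiagram.card_le_card h2.1
        rw [show μ.card - κ.card = (μ.card - ν.card) + (ν.card - κ.card) by omega, neg_pow, pow_add]
        ring
      · simp [h2]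
    · simp [h1]
  calc specialize b (schur μ)
      = ∑ κ ∈ μ.subdiagrams, y ^ (μ.card - κ.card) * specialize b (schur κ) *
          if κ = μ then 1 else 0 := by
        simp
    _ = ∑ κ ∈ μ.subdiagrams, ∑ ν ∈ μ.subdiagrams, y ^ (μ.card - κ.card) *
          specialize b (schur κ) * if ν.IsVerticalStrip μ ∧ κ.IsHorizontalStrip ν then
            (-1) ^ (μ.card - ν.card) else 0 := by
        refine Finset.sum_congr rfl fun κ _ => ?_
        rw [← YoungDiagram.sum_strips R κ μ, Finset.sum_filter, Finset.mul_sum]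
    _ = ∑ ν ∈ μ.subdiagrams, if ν.IsVerticalStrip μ then
          (-y) ^ (μ.card - ν.card) * specialize a (schur ν) else 0 := by
        rw [Finset.sum_comm]
        refine Finset.sum_congr rfl fun ν hν => ?_
        simp only [← hterm]
        rw [hadd ν hν, Finset.mul_sum]
        split_ifs <;> simp
    _ = _ := (Finset.sum_filter _ _).symm

/-- In the empty alphabet, all Schur functions vanish except the one of the empty diagram. -/
theorem specialize_zero_schur {R : Type*} [CommRing R] [Algebra ℚ R] (μ : YoungDiagram)
    [Decidable (μ = ⊥)] : specialize (fun _ => (0 : R)) (schur μ) = if μ = ⊥ then 1 else 0 := by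
  have h0 : restrictVars (Set.Iio 0) (schurSeries μ) = if μ = ⊥ then 1 else 0 := by
    rw [SemistandardYoungTableau.restrictVars_schurSeries]
    exact SignedTableau.sum_tableauxIn_empty (fun l => X (SemistandardYoungTableau.letterIndex l)) μ
  have h1 := congrArg (coeff 0) h0
  rw [coeff_restrictVars_of_subset _ (by simp)] at h1
  let φ : SymFun →ₐ[ℚ] R := (Algebra.ofId ℚ R).comp
    (((constantCoeff : MvPowerSeries ℕ ℚ →+* ℚ).toRatAlgHom).comp SymFun.val)
  have hφ : ∀ f, φ f = algebraMap ℚ R (coeff 0 f.1) := fun f => rfl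
  rw [← eq_specialize _ φ, hφ]
  · refine (congrArg _ h1).trans ?_
    split_ifs <;> simp
  · intro k hk
    rw [hφ, ← coeff_restrictVars_of_subset (s := Set.Iio 0) _ (by simp), restrictVars_p 0 hk]
    simp

end SymFun

/-! ### The identity for finite and for arbitrary alphabets -/

namespace SignedTableau

/-- The identity for a finite alphabet, with the variables specialized to elements of a ring. The
tableaux and the Schur function satisfy the same branching rule for the greatest letter. -/
theorem sum_tableauxIn_eq_specialize {α β R : Type*} [LinearOrder α] [LinearOrder β] [CommRing R]
    [Algebra ℚ R] (x : α → R) (y : β → R) (S : Finset (β ⊕ₗ α)) (μ : YoungDiagram) :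
    ∑ T ∈ tableauxIn S μ, ∏ c, Sum.elim (fun b => -y b) x (ofLex (T.entry c)) =
      SymFun.specialize
        (fun k => ∑ l ∈ S, Sum.elim (fun b => -y b ^ k) (fun a => x a ^ k) (ofLex l))
        (SymFun.schur μ) := by
  classical
  induction S using Finset.induction_on_max generalizing μ with
  | empty =>
    simp only [Finset.sum_empty]
    rw [SymFun.specialize_zero_schur]
    exact sum_tableauxIn_empty (fun l => Sum.elim (fun b => -y b) x (ofLex l)) μ
  | insert l S hl ih =>
    have hS : l ∉ S := fun h => lt_irrefl l (hl l h)
    refine (sum_tableauxIn_insert (fun l => Sum.elim (fun b => -y b) x (ofLex l)) S l hl μ).trans ?_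
    simp only [ih, Finset.sum_insert hS]
    obtain ⟨l, rfl⟩ := toLex.surjective l
    rcases l with b | a
    · simp only [ofLex_toLex, Sum.elim_inl, neg_add_eq_sub]
      rw [SymFun.specialize_sub_schur]
      exact Finset.sum_congr (Finset.filter_congr fun ν _ => Iff.rfl) fun ν _ => rfl
    · simp only [ofLex_toLex, Sum.elim_inr, add_comm (x a ^ _)]
      rw [SymFun.specialize_add_schur]
      exact Finset.sum_congr (Finset.filter_congr fun ν _ => Iff.rfl) fun ν _ => rfl

end SignedTableau

open Classical in
theorem coeff_rename_powerSum {σ τ : Type*} (e : σ ↪ τ) (k : ℕ) (m : τ →₀ ℕ) :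
    coeff m (rename e (powerSum σ k)) =
      if ∃ i, i ∈ Set.range e ∧ m = Finsupp.single i k then 1 else 0 := by
  by_cases hm : m ∈ Set.range (Finsupp.embDomain (M := ℕ) e)
  · obtain ⟨u, rfl⟩ := hm
    rw [coeff_embDomain_rename, coeff_powerSum]
    congr 1
    simp only [Set.exists_range_iff, ← Finsupp.embDomain_single,
      (Finsupp.embDomain_injective e).eq_iff]
  · rw [coeff_rename_eq_zero, if_neg]
    · rintro ⟨_, ⟨j, rfl⟩, rfl⟩
      exact hm ⟨Finsupp.single j k, Finsupp.embDomain_single _ _ _⟩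
    · rintro ⟨u, rfl⟩
      exact hm ⟨u, Finsupp.embDomain_eq_mapDomain _ _⟩

/-- The letter of `X - Y` whose weight is, up to sign, a given variable. -/
def letterOfVar (α β : Type*) : α ⊕ β ≃ β ⊕ₗ α := (Equiv.sumComm α β).trans toLex

theorem restrictVars_powerSumDiff {α β : Type*} (s : Finset (α ⊕ β)) {k : ℕ} (hk : k ≠ 0) :
    restrictVars s (powerSumDiff α β k) = ∑ l ∈ s.map (letterOfVar α β).toEmbedding,
      Sum.elim (fun b => -X (Sum.inr b) ^ k) (fun a => X (Sum.inl a) ^ k) (ofLex l) := by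
  classical
  rw [powerSumDiff, map_sub, restrictVars_powerSum s _ hk _ (coeff_rename_powerSum _ k),
    restrictVars_powerSum s _ hk _ (coeff_rename_powerSum _ k), Finset.sum_map, Finset.sum_filter,
    Finset.sum_filter, ← Finset.sum_sub_distrib]
  refine Finset.sum_congr rfl fun i _ => ?_
  rcases i with a | b <;> simp [letterOfVar]

end

theorem theorem2 {α β : Type*} [LinearOrder α] [LinearOrder β] (μ : YoungDiagram) :
    HasSum (fun T : SignedTableau α β μ => T.weight)
      (SymFun.specialize (powerSumDiff α β) (SymFun.schur μ)) := by
  rw [MvPowerSeries.WithPiTopology.hasSum_iff_hasSum_coeff]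
  intro m
  set S := m.support.map (letterOfVar α β).toEmbedding with hS
  have hcoeff : MvPowerSeries.coeff m (SymFun.specialize (powerSumDiff α β) (SymFun.schur μ)) =
      ∑ T ∈ SignedTableau.tableauxIn S μ, MvPowerSeries.coeff m T.weight := by
    rw [← coeff_restrictVars_of_subset _ (subset_refl _), SymFun.map_specialize,
      SymFun.specialize_congr fun k hk => restrictVars_powerSumDiff m.support hk,
      ← SignedTableau.sum_tableauxIn_eq_specialize, map_sum]
    rfl
  rw [hcoeff]
  refine hasSum_sum_of_ne_finset_zero fun T hT => ?_
  -- The weight of `T` is divisible by a variable that does not occur in the monomial `m`.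
  rw [SignedTableau.mem_tableauxIn, not_forall] at hT
  obtain ⟨c, hc⟩ := hT
  obtain ⟨i, hi⟩ := (letterOfVar α β).surjective (T.entry c)
  have him : m i = 0 := by
    by_contra h
    exact hc (Finset.mem_map.2 ⟨i, Finsupp.mem_support_iff.2 h, hi⟩)
  refine MvPowerSeries.X_dvd_iff.1 (Dvd.dvd.trans ?_ (Finset.dvd_prod_of_mem _
    (Finset.mem_univ c))) m him
  rw [← hi]
  rcases i with a | b
  exacts [dvd_rfl, (dvd_neg (a := MvPowerSeries.X (Sum.inr b))).2 dvd_rfl]
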